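/- **Setting.** Let $d\ge 1$. A classification problem $P=\mathbb P_{X,Y}$ is given by a measurable regression function $\eta:\mathbb R^d\to[0,1]$, with $\eta(x)=\mathbb P(Y=1\mid X=x)$ for $x\in[0,1]^d$, and a marginal law $\mathbb P_X$ on $[0,1]^d$; labels $Y$ are in $\{0,1\}$. Let $R(f)=\mathbb P(Y\ne f(X))$, let $f^*=\mathbf 1\{\eta\ge 1/2\}$ be the Bayes classifier, and let $\mathcal E_P(f)=R(f)-R(f^*)$ be the excess risk. For $\alpha>0$, $\lambda\ge 1$, $c_3>0$ and $0<c_1\le 1$, let $\mathcal P^*(\alpha,1,0)=\mathcal P^*(\alpha,1,0;\lambda,c_3,c_1)$ be the set of classification problems such that 1. (Hölder smoothness) $\eta$ is $\lfloor\alpha\rfloor$ times continuously differentiable on $\mathbb R^d$, $\sum_{|s|=j}|D^s\eta(x)|\le\lambda$ for all integers $0\le j\le\alpha$ and all $x\in\mathbb R^d$, and $\sum_{|s|=\lfloor\alpha\rfloor}|D^s\eta(x)-D^s\eta(y)|\le\lambda\,|x-y|_2^{\alpha-\lfloor\alpha\rfloor}$ for all $x\neq y$ in $\mathbb R^d$;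 2. (margin condition with $\beta=1$, $\Delta_0=0$) $\mathbb P_X(|\eta(X)-1/2|\le\Delta)\le c_3\Delta$ for all $\Delta>0$; 3. (strong density) for every $l\ge 0$, each cell $Q$ of the dyadic partition of $[0,1]^d$ into $2^{ld}$ cubes of side $2^{-l}$ with $\mathbb P_X(Q)>0$ satisfies $\mathbb P_X(Q)\ge c_1 2^{-ld}$. A (possibly active, possibly randomized) strategy with budget $n$ requests at most $n$ labels, one after the other, at points of $\mathbb R^d$ that it chooses from its internal randomness, from information about $\mathbb P_X$ (for example unlabeled draws of $X$), and from the labels seen so far; given the past, the label requested at $x$ is Bernoulli with parameter $\eta(x)$. It then returns a measurable classifier $\widehat f_n:[0,1]^d\to\{0,1\}$ based on all it has seen. **Theorem (Lower bound).** Let $d\ge 1$ and $\alpha>0$. There are $\lambda_0\ge 1$ and $c_0>0$, depending only on $\alpha$ and $d$, such that for all $\lambda\ge\lambda_0$, $c_3\ge c_0$ and $c_1\in(0,1]$ there are $C>0$ and $N\in\mathbb N$ for which the following holds. For every $n\ge N$ and every possibly active strategy that samples at most $n$ labels and returns a classifier $\widehat f_n$, $$\sup_{P\in\mathcal P^*(\alpha,1,0)}\mathbb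 E_P\big[\mathcal E_P(\widehat f_n)\big]\;\ge\; C\,n^{-\frac{2\alpha}{2\alpha+d-1}}.$$ The constant $C$ does not depend on $n$ or on the strategy. -/

import Mathlib

open MeasureTheory

noncomputable section

namespace ActiveLearning

/-- The feature space `ℝ^d` with its Euclidean norm. -/
abbrev Feature (d : ℕ) : Type := EuclideanSpace ℝ (Fin d)

/-- The unit cube `[0,1]^d`. -/
def unitCube (d : ℕ) : Set (Feature d) := {x | ∀ i, 0 ≤ x i ∧ x i ≤ 1}

/-- A binary classification problem, given by the regression function `eta x = P(Y = 1 | X = x)`,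
extended to all of `ℝ^d`, and by the marginal law of `X`, which lives on `[0,1]^d`. -/
structure ClassificationProblem (d : ℕ) where
  eta : Feature d → ℝ
  marginal : Measure (Feature d)
  measurable_eta : Measurable eta
  eta_mem : ∀ x, eta x ∈ Set.Icc (0 : ℝ) 1
  isProbabilityMeasure_marginal : IsProbabilityMeasure marginal
  marginal_compl_unitCube : marginal (unitCube d)ᶜ = 0

/-! ### Joint law, risk and excess risk (labels are `true` for `1` and `false` for `0`) -/

/-- The joint law of `(X, Y)`. -/
def ClassificationProblem.joint {d : ℕ} (P : ClassificationProblem d) :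
    Measure (Feature d × Bool) :=
  (P.marginal.withDensity (fun x => ENNReal.ofReal (P.eta x))).map (fun x => (x, true)) +
  (P.marginal.withDensity (fun x => ENNReal.ofReal (1 - P.eta x))).map (fun x => (x, false))

/-- The `0`-`1` risk `R(f) = P(Y ≠ f(X))`. -/
def ClassificationProblem.risk {d : ℕ} (P : ClassificationProblem d) (f : Feature d → Bool) : ℝ :=
  P.joint.real {z | z.2 ≠ f z.1}

/-- The Bayes classifier `f*(x) = 1{eta(x) ≥ 1/2}`. -/
def ClassificationProblem.bayes {d : ℕ} (P : ClassificationProblem d) (x : Feature d) : Bool :=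
  decide (1 / 2 ≤ P.eta x)

/-- The excess risk `R(f) - R(f*)`. -/
def ClassificationProblem.excessRisk {d : ℕ} (P : ClassificationProblem d)
    (f : Feature d → Bool) : ℝ :=
  P.risk f - P.risk P.bayes

/-! ### Hölder class, margin condition, strong density -/

/-- The sum `∑_{|s| = j} |T(e^s)|` over multi-indices `s` of order `j`, for a `j`-linear form `T`.
A multi-index `s` of order `j` is listed as the nondecreasing sequence `i` of length `j` in which
the coordinate `m` occurs `s m` times; for `T` the `j`-th derivative of a `C^j` function `g` at `x`,
the value of `T` at `(e_{i 0}, …, e_{i (j-1)})` is the mixed partial derivative `D^s g(x)`. -/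
def sumMultiIndex {d : ℕ} (j : ℕ) (T : (Fin j → Feature d) → ℝ) : ℝ :=
  open scoped Classical in
  ∑ i : {i : Fin j → Fin d // Monotone i},
    |T (fun t => EuclideanSpace.single (i.1 t) (1 : ℝ))|

/-- The Hölder class `Σ(lam, α)` of functions `ℝ^d → [0,1]`. -/
structure IsHolder {d : ℕ} (lam α : ℝ) (g : Feature d → ℝ) : Prop where
  mem_Icc : ∀ x, g x ∈ Set.Icc (0 : ℝ) 1
  contDiff : ContDiff ℝ (⌊α⌋₊ : ℕ) g
  deriv_le : ∀ j : ℕ, (j : ℝ) ≤ α → ∀ x, sumMultiIndex j (fun v => iteratedFDeriv ℝ j g x v) ≤ lam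
  holder_le : ∀ x y,
    sumMultiIndex ⌊α⌋₊ (fun v => iteratedFDeriv ℝ ⌊α⌋₊ g x v - iteratedFDeriv ℝ ⌊α⌋₊ g y v) ≤
      lam * ‖x - y‖ ^ (α - (⌊α⌋₊ : ℝ))

/-- The margin condition with parameters `β`, `Δ₀`, `c₃`. -/
structure MarginCondition {d : ℕ} (P : ClassificationProblem d) (β Δ₀ c₃ : ℝ) : Prop where
  margin_zero : P.marginal.real {x | |P.eta x - 1 / 2| < Δ₀} = 0
  margin_le : ∀ Δ : ℝ, 0 < Δ → P.marginal.real {x | |P.eta x - 1 / 2| ≤ Δ₀ + Δ} ≤ c₃ * Δ ^ β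

/-- The cell with index `k` of the dyadic grid `G_l` of mesh `2^{-l}`. The cells are half-open
cubes, closed where they touch an upper face of `[0,1]^d`, so that they partition `[0,1]^d`. -/
def dyadicCell (d l : ℕ) (k : Fin d → Fin (2 ^ l)) : Set (Feature d) :=
  {x | ∀ i, ((k i : ℕ) : ℝ) / 2 ^ l ≤ x i ∧
    (x i < (((k i : ℕ) : ℝ) + 1) / 2 ^ l ∨ ((k i : ℕ) + 1 = 2 ^ l ∧ x i = 1))}

/-- Strong density with constant `c₁`: every dyadic cell of positive mass has mass at least
`c₁ 2^{-ld}`. -/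
def StrongDensity {d : ℕ} (μ : Measure (Feature d)) (c₁ : ℝ) : Prop :=
  ∀ (l : ℕ) (k : Fin d → Fin (2 ^ l)), 0 < μ.real (dyadicCell d l k) →
    c₁ * ((2 : ℝ) ^ (l * d))⁻¹ ≤ μ.real (dyadicCell d l k)

/-- The class `P(α, β, Δ₀; lam, c₃)`. -/
def problemClass (d : ℕ) (α β Δ₀ lam c₃ : ℝ) : Set (ClassificationProblem d) :=
  {P | IsHolder lam α P.eta ∧ MarginCondition P β Δ₀ c₃}

/-- The class `P*(α, β, Δ₀; lam, c₃)`, with strong density constant `c₁`. -/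
def strongProblemClass (d : ℕ) (α β Δ₀ lam c₃ c₁ : ℝ) : Set (ClassificationProblem d) :=
  {P | P ∈ problemClass d α β Δ₀ lam c₃ ∧ StrongDensity P.marginal c₁}

/-! ### Strategies -/

/-- A possibly active, possibly randomized strategy that requests at most `n` labels.

The learner first draws a seed `ω`, which holds its internal randomness. The law of the seed may
depend on the marginal law of `X`: so the seed may also hold unlabeled draws of `X`, which makes
passive learners (who request the labels of i.i.d. draws of `X`) a special case.

In round `k` the learner chooses, from the seed and the labels of rounds `0, …, k - 1`, either a
point `x` of `ℝ^d` whose label it requests (`Sum.inr x`) or not to request a label (`Sum.inl ()`;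
`false` is then recorded). The earlier request points are functions of the seed and the earlier
labels. After the `n` rounds it returns a classifier. -/
structure Strategy (d n : ℕ) (Ω : Type*) [MeasurableSpace Ω] where
  seedLaw : Measure (Feature d) → Measure Ω
  query : (k : Fin n) → (Fin k → Bool) → Ω → Unit ⊕ Feature d
  classifier : (Fin n → Bool) → Ω → Feature d → Bool
  isProbabilityMeasure_seedLaw : ∀ μ : Measure (Feature d),
    IsProbabilityMeasure μ → IsProbabilityMeasure (seedLaw μ)
  measurable_query : ∀ k h, Measurable (query k h)
  measurable_classifier : ∀ y, Measurable (fun z : Ω × Feature d => classifier y z.1 z.2)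

/-- Mass that the Bernoulli law of parameter `p` gives to the label `b`. -/
def bernoulliMass (p : ℝ) (b : Bool) : ℝ := if b then p else 1 - p

/-- Conditional probability, given the seed `ω`, that the recorded labels are `y`: the label
requested at `x` is Bernoulli of parameter `eta x`, given the past. -/
def Strategy.labelProb {d n : ℕ} {Ω : Type*} [MeasurableSpace Ω] (S : Strategy d n Ω)
    (eta : Feature d → ℝ) (ω : Ω) (y : Fin n → Bool) : ℝ :=
  ∏ k : Fin n, bernoulliMass
    (Sum.elim (fun _ => 0) eta (S.query k (fun j => y (Fin.castLE k.isLt.le j)) ω)) (y k)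

/-- The expected excess risk of the classifier returned by `S` on the problem `P`. -/
def Strategy.expectedExcessRisk {d n : ℕ} {Ω : Type*} [MeasurableSpace Ω] (S : Strategy d n Ω)
    (P : ClassificationProblem d) : ENNReal :=
  ∫⁻ ω, ∑ y : Fin n → Bool,
    ENNReal.ofReal (S.labelProb P.eta ω y) * ENNReal.ofReal (P.excessRisk (S.classifier y ω))
    ∂(S.seedLaw P.marginal)

end ActiveLearning

end

/-!
The proof is a minimax argument over a hypercube of problems. Write `d = e + 1` and let the marginal
be uniform. Cut the last `e` coordinates into `m ^ e` cells, so that the cube falls into `m ^ e`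
tubes parallel to the first axis. For a choice `σ` of one sign per tube the regression function is
`1/2 + (1/4) sin (x 0 - 1/2) + δ * (signed sum of bumps)`, where the bump of a tube depends on the
last `e` coordinates only, lives at scale `1/m`, and `δ = m ^ (-α) / 8`.

* The scaling of the bumps keeps all these functions in one Hölder class
  (`exists_isHolder_regression`). On lines in the direction of the first axis their slope is bounded
  below, which is the margin condition with `β = 1` (`uniformLaw_margin_le`), for every `α`.
* The sign of a tube moves the decision boundary by about `δ`, so a wrong guess of it costs
  `|2 η - 1| ≈ δ` on a region of volume `≈ δ m ^ (-e)`
  (`ClassificationProblem.sum_le_excessRisk`).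
* A label requested in a tube tells its sign apart only up to squared Hellinger distance `O(δ ^ 2)`,
  wherever in the tube it is requested, and says nothing about the other tubes
  (`sum_bernoulliHellinger_regression_le`). So active choice of the points does not help: the squared
  Hellinger distance is subadditive over adaptively chosen rounds
  (`sum_sq_sqrt_adaptiveProb_sub_le`), and Assouad's lemma (`assouad`) shows that `n` labels leave a
  fixed proportion of the signs undecided as long as `n δ ^ 2` is at most a small multiple of `m ^ e`.

With `m ≈ n ^ (1 / (2 α + e))` this condition holds, and the resulting expected excess risk,
averaged over the hypercube, is of the order `m ^ e * δ * δ m ^ (-e) = δ ^ 2 ≈ n ^ (-2α / (2α + e))`.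
The randomness of the learner is dealt with seed by seed: the law of the seed is the same for all
vertices because they share the marginal (`Strategy.le_iSup_expectedExcessRisk`).
-/

namespace ActiveLearning

/-! ### Adaptive label sequences and their Hellinger distance -/

lemma bernoulliMass_nonneg {p : ℝ} (hp : p ∈ Set.Icc (0 : ℝ) 1) (b : Bool) :
    0 ≤ bernoulliMass p b := by
  unfold bernoulliMass
  split_ifs <;> linarith [hp.1, hp.2]

lemma sum_bernoulliMass (p : ℝ) : ∑ b : Bool, bernoulliMass p b = 1 := by
  simp [bernoulliMass]

/-- Squared Hellinger distance (without the factor `1/2`) of two Bernoulli laws. -/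
noncomputable def bernoulliHellinger (p q : ℝ) : ℝ :=
  ∑ b : Bool, (√(bernoulliMass p b) - √(bernoulliMass q b)) ^ 2

lemma bernoulliHellinger_self (p : ℝ) : bernoulliHellinger p p = 0 := by
  simp [bernoulliHellinger]

lemma bernoulliHellinger_comm (p q : ℝ) : bernoulliHellinger p q = bernoulliHellinger q p := by
  unfold bernoulliHellinger
  exact Finset.sum_congr rfl fun b _ => by ring

lemma sq_sqrt_sub_sqrt_le {a b : ℝ} (ha : 1 / 8 ≤ a) (hb : 1 / 8 ≤ b) :
    (√a - √b) ^ 2 ≤ 2 * (a - b) ^ 2 := by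
  have h1 : a = √a ^ 2 := (Real.sq_sqrt (by linarith)).symm
  have h2 : b = √b ^ 2 := (Real.sq_sqrt (by linarith)).symm
  set u := √a
  set v := √b
  have hu : 0 ≤ u := Real.sqrt_nonneg a
  have hv : 0 ≤ v := Real.sqrt_nonneg b
  have h3 : 1 / 2 ≤ (u + v) ^ 2 := by nlinarith [mul_nonneg hu hv, sq_nonneg (u - v)]
  have h4 : (a - b) ^ 2 = (u - v) ^ 2 * (u + v) ^ 2 := by rw [h1, h2]; ring
  rw [h4]
  nlinarith [sq_nonneg (u - v)]

lemma bernoulliHellinger_le {p q : ℝ} (hp : p ∈ Set.Icc (1 / 8 : ℝ) (7 / 8))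
    (hq : q ∈ Set.Icc (1 / 8 : ℝ) (7 / 8)) : bernoulliHellinger p q ≤ 4 * (p - q) ^ 2 := by
  have h1 := sq_sqrt_sub_sqrt_le hp.1 hq.1
  have h2 := sq_sqrt_sub_sqrt_le (a := 1 - p) (b := 1 - q) (by linarith [hp.2]) (by linarith [hq.2])
  simp only [bernoulliHellinger, bernoulliMass, Fintype.sum_bool, if_true, Bool.false_eq_true,
    if_false]
  nlinarith

/-- Probability of the label sequence `y` when, given the labels of the rounds before `k`, the
label of round `k` is Bernoulli with a parameter `a k` that depends on these labels. -/
def adaptiveProb {n : ℕ} (a : (k : Fin n) → (Fin k → Bool) → ℝ) (y : Fin n → Bool) : ℝ :=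
  ∏ k : Fin n, bernoulliMass (a k (fun j => y (Fin.castLE k.isLt.le j))) (y k)

lemma adaptiveProb_nonneg {n : ℕ} {a : (k : Fin n) → (Fin k → Bool) → ℝ}
    (ha : ∀ k h, a k h ∈ Set.Icc (0 : ℝ) 1) (y : Fin n → Bool) : 0 ≤ adaptiveProb a y :=
  Finset.prod_nonneg fun k _ => bernoulliMass_nonneg (ha k _) _

lemma adaptiveProb_snoc {n : ℕ} (a : (k : Fin (n + 1)) → (Fin k → Bool) → ℝ) (y : Fin n → Bool)
    (b : Bool) :
    adaptiveProb a (Fin.snoc (α := fun _ => Bool) y b) =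
      adaptiveProb (fun k h => a k.castSucc h) y * bernoulliMass (a (Fin.last n) y) b := by
  unfold adaptiveProb
  rw [Fin.prod_univ_castSucc]
  congr 1
  · refine Finset.prod_congr rfl fun k _ => ?_
    rw [Fin.snoc_castSucc]
    congr 2
    funext j
    exact Fin.snoc_castSucc (α := fun _ => Bool) b y (Fin.castLE k.isLt.le j)
  · rw [Fin.snoc_last]
    congr 2
    funext j
    exact Fin.snoc_castSucc (α := fun _ => Bool) b y j

lemma sum_bool_sequence_succ {n : ℕ} (f : (Fin (n + 1) → Bool) → ℝ) :
    ∑ y, f y = ∑ y : Fin n → Bool, ∑ b : Bool, f (Fin.snoc (α := fun _ => Bool) y b) := by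
  rw [← (Fin.snocEquiv (fun _ => Bool)).sum_comp, Fintype.sum_prod_type, Finset.sum_comm]
  rfl

lemma sum_adaptiveProb {n : ℕ} (a : (k : Fin n) → (Fin k → Bool) → ℝ) :
    ∑ y, adaptiveProb a y = 1 := by
  induction n with
  | zero => simp [adaptiveProb]
  | succ n ih =>
    rw [sum_bool_sequence_succ]
    simp_rw [adaptiveProb_snoc, ← Finset.mul_sum, sum_bernoulliMass, mul_one]
    exact ih _

/-- Tensorization of the squared Hellinger distance for adaptively chosen experiments: the
distance of the two laws of the label sequence is at most the sum over the rounds of the expected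
distance of the laws of one label, the expectation being taken under the average of the two laws.
With `ρ = ∑ √(p q)` the Hellinger affinity, one more round decreases `ρ` by
`∑ √(p q) (1 - ρ_round)`, and `√(p q) ≤ (p + q) / 2`. -/
lemma sum_sq_sqrt_adaptiveProb_sub_le {n : ℕ} (a b : (k : Fin n) → (Fin k → Bool) → ℝ)
    (ha : ∀ k h, a k h ∈ Set.Icc (0 : ℝ) 1) (hb : ∀ k h, b k h ∈ Set.Icc (0 : ℝ) 1) :
    ∑ y, (√(adaptiveProb a y) - √(adaptiveProb b y)) ^ 2 ≤
      ∑ y, (adaptiveProb a y + adaptiveProb b y) / 2 *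
        ∑ k : Fin n, bernoulliHellinger (a k (fun j => y (Fin.castLE k.isLt.le j)))
          (b k (fun j => y (Fin.castLE k.isLt.le j))) := by
  induction n with
  | zero => simp [adaptiveProb]
  | succ n ih =>
    have ih' := ih (fun k h => a k.castSucc h) (fun k h => b k.castSucc h)
      (fun k h => ha _ _) (fun k h => hb _ _)
    rw [sum_bool_sequence_succ, sum_bool_sequence_succ]
    set p := adaptiveProb (fun k h => a k.castSucc h) with hp
    set q := adaptiveProb (fun k h => b k.castSucc h) with hq
    have hp0 : ∀ y, 0 ≤ p y := adaptiveProb_nonneg fun k h => ha _ _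
    have hq0 : ∀ y, 0 ≤ q y := adaptiveProb_nonneg fun k h => hb _ _
    have hround : ∀ (y : Fin n → Bool) (c : Bool),
        ∑ k : Fin (n + 1), bernoulliHellinger
          (a k (fun j => Fin.snoc (α := fun _ => Bool) y c (Fin.castLE k.isLt.le j)))
          (b k (fun j => Fin.snoc (α := fun _ => Bool) y c (Fin.castLE k.isLt.le j))) =
        ∑ k : Fin n, bernoulliHellinger
          (a k.castSucc (fun j => y (Fin.castLE k.isLt.le j)))
          (b k.castSucc (fun j => y (Fin.castLE k.isLt.le j))) +
        bernoulliHellinger (a (Fin.last n) y) (b (Fin.last n) y) := by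
      intro y c
      rw [Fin.sum_univ_castSucc]
      have h1 : ∀ k : Fin n, (fun j : Fin k => (Fin.snoc (α := fun _ => Bool) y c : _ → Bool)
          (Fin.castLE k.castSucc.isLt.le j)) = fun j => y (Fin.castLE k.isLt.le j) := fun k =>
        funext fun j => Fin.snoc_castSucc (α := fun _ => Bool) c y (Fin.castLE k.isLt.le j)
      have h2 : (fun j : Fin n => (Fin.snoc (α := fun _ => Bool) y c : _ → Bool)
          (Fin.castLE (Fin.last n).isLt.le j)) = y :=
        funext fun j => Fin.snoc_castSucc (α := fun _ => Bool) c y j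
      congr 1
      · exact Finset.sum_congr rfl fun k _ => congrArg₂ _ (congrArg _ (h1 k)) (congrArg _ (h1 k))
      · exact congrArg₂ _ (congrArg _ h2) (congrArg _ h2)
    simp_rw [adaptiveProb_snoc, ← hp, ← hq, hround]
    refine le_trans (b := ∑ y, ((√(p y) - √(q y)) ^ 2 + (p y + q y) / 2 *
      bernoulliHellinger (a (Fin.last n) y) (b (Fin.last n) y))) ?_ ?_
    · refine Finset.sum_le_sum fun y _ => ?_
      have hA : ∀ c, 0 ≤ bernoulliMass (a (Fin.last n) y) c := bernoulliMass_nonneg (ha _ _)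
      have hB : ∀ c, 0 ≤ bernoulliMass (b (Fin.last n) y) c := bernoulliMass_nonneg (hb _ _)
      have sA := sum_bernoulliMass (a (Fin.last n) y)
      have sB := sum_bernoulliMass (b (Fin.last n) y)
      simp only [bernoulliHellinger, Fintype.sum_bool, Real.sqrt_mul (hp0 y),
        Real.sqrt_mul (hq0 y)] at sA sB ⊢
      have e1 := Real.sq_sqrt (hp0 y)
      have e2 := Real.sq_sqrt (hq0 y)
      have e3 := Real.sq_sqrt (hA true)
      have e4 := Real.sq_sqrt (hA false)
      have e5 := Real.sq_sqrt (hB true)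
      have e6 := Real.sq_sqrt (hB false)
      rw [← e3, ← e4] at sA
      rw [← e5, ← e6] at sB
      rw [← e1, ← e2]
      simp only [Real.sqrt_sq (Real.sqrt_nonneg _)]
      set P := √(p y)
      set Q := √(q y)
      set u := √(bernoulliMass (a (Fin.last n) y) true)
      set v := √(bernoulliMass (a (Fin.last n) y) false)
      set w := √(bernoulliMass (b (Fin.last n) y) true)
      set z := √(bernoulliMass (b (Fin.last n) y) false)
      have key : (P ^ 2 + Q ^ 2) / 2 * ((u - w) ^ 2 + (v - z) ^ 2) + (P - Q) ^ 2 -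
          ((P * u - Q * w) ^ 2 + (P * v - Q * z) ^ 2) =
          (P - Q) ^ 2 / 2 * ((u - w) ^ 2 + (v - z) ^ 2) := by
        linear_combination (P * Q - P ^ 2) * sA + (P * Q - Q ^ 2) * sB
      nlinarith [mul_nonneg (sq_nonneg (P - Q)) (add_nonneg (sq_nonneg (u - w)) (sq_nonneg (v - z)))]
    · have hs : ∀ (y : Fin n → Bool) (R : ℝ), ∑ c : Bool,
          (p y * bernoulliMass (a (Fin.last n) y) c + q y * bernoulliMass (b (Fin.last n) y) c) / 2 *
            R = (p y + q y) / 2 * R := by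
        intro y R
        rw [← Finset.sum_mul, ← Finset.sum_div, Finset.sum_add_distrib, ← Finset.mul_sum,
          ← Finset.mul_sum, sum_bernoulliMass, sum_bernoulliMass, mul_one, mul_one]
      simp_rw [hs, mul_add]
      rw [Finset.sum_add_distrib, Finset.sum_add_distrib]
      exact add_le_add ih' le_rfl

/-! ### Assouad's lemma for adaptive label sequences -/

/-- The vertex of the hypercube that differs from `σ` in the coordinate `k` only. -/
def flip {κ : Type*} [DecidableEq κ] (k : κ) (σ : κ → Bool) : κ → Bool :=
  Function.update σ k (!σ k)

lemma flip_flip {κ : Type*} [DecidableEq κ] (k : κ) (σ : κ → Bool) : flip k (flip k σ) = σ := by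
  funext j
  by_cases h : j = k
  · subst h; simp [flip]
  · simp [flip, h]

lemma flip_apply_self {κ : Type*} [DecidableEq κ] (k : κ) (σ : κ → Bool) :
    flip k σ k = !σ k := by simp [flip]

lemma flip_apply_of_ne {κ : Type*} [DecidableEq κ] {j k : κ} (h : j ≠ k) (σ : κ → Bool) :
    flip k σ j = σ j := by simp [flip, h]

lemma sum_flip {κ : Type*} [Fintype κ] [DecidableEq κ] (k : κ) (f : (κ → Bool) → ℝ) :
    ∑ σ, f (flip k σ) = ∑ σ, f σ :=
  Equiv.sum_comp (Function.Involutive.toPerm (flip k) (flip_flip k)) f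

/-- Summed over a finite sample space: the overlap of two probability laws is at least
`1/2 - H/2`, with `H` their squared Hellinger distance. -/
lemma min_ge_sub_sq_sqrt {p q : ℝ} (hp : 0 ≤ p) (hq : 0 ≤ q) :
    (p + q) / 4 - (√p - √q) ^ 2 / 2 ≤ min p q := by
  have e1 := Real.sq_sqrt hp
  have e2 := Real.sq_sqrt hq
  rw [← e1, ← e2]
  simp only [Real.sqrt_sq (Real.sqrt_nonneg _)]
  refine le_min ?_ ?_
  · nlinarith [sq_nonneg (√q - 2 * √p)]
  · nlinarith [sq_nonneg (√p - 2 * √q)]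

/-- Assouad's lemma for a family of adaptive experiments indexed by the hypercube: if in every
round the vertex `σ` is at total squared Hellinger distance at most `ε` from its neighbours, and a
wrong decision about a coordinate costs at least `v`, then the total cost, summed over all
vertices, is at least that of a fixed proportion of the coordinates being wrong. -/
lemma assouad {κ : Type*} [Fintype κ] [DecidableEq κ] {n : ℕ}
    (a : (κ → Bool) → (t : Fin n) → (Fin t → Bool) → ℝ)
    (ha : ∀ σ t h, a σ t h ∈ Set.Icc (0 : ℝ) 1) {ε v : ℝ}
    (hε : ∀ σ t h, ∑ k, bernoulliHellinger (a σ t h) (a (flip k σ) t h) ≤ ε)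
    (cost : (Fin n → Bool) → κ → Bool → ℝ) (hcost : ∀ y k b, 0 ≤ cost y k b)
    (hv : ∀ y k, v ≤ cost y k true + cost y k false) (hv0 : 0 ≤ v) :
    2 ^ Fintype.card κ * (v / 4 * (Fintype.card κ - n * ε)) ≤
      ∑ σ, ∑ y, adaptiveProb (a σ) y * ∑ k, cost y k (σ k) := by
  set p : (κ → Bool) → (Fin n → Bool) → ℝ := fun σ => adaptiveProb (a σ) with hpdef
  have hp0 : ∀ σ y, 0 ≤ p σ y := fun σ y => adaptiveProb_nonneg (ha σ) y
  have hp1 : ∀ σ, ∑ y, p σ y = 1 := fun σ => sum_adaptiveProb (a σ)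
  set H : κ → (κ → Bool) → ℝ := fun k σ => ∑ y, (√(p σ y) - √(p (flip k σ) y)) ^ 2 with hH
  set r : κ → (κ → Bool) → (Fin n → Bool) → ℝ := fun k σ y => ∑ t : Fin n,
    bernoulliHellinger (a σ t (fun j => y (Fin.castLE t.isLt.le j)))
      (a (flip k σ) t (fun j => y (Fin.castLE t.isLt.le j))) with hr
  have hrflip : ∀ k σ y, r k (flip k σ) y = r k σ y := by
    intro k σ y
    simp only [hr, flip_flip]
    exact Finset.sum_congr rfl fun t _ => bernoulliHellinger_comm _ _
  have hHsum : ∑ σ, ∑ k, H k σ ≤ 2 ^ Fintype.card κ * (n * ε) := by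
    have h1 : ∀ k, ∑ σ, H k σ ≤ ∑ σ, ∑ y, p σ y * r k σ y := by
      intro k
      have h2 : ∑ σ, H k σ ≤ ∑ σ, ∑ y, (p σ y + p (flip k σ) y) / 2 * r k σ y :=
        Finset.sum_le_sum fun σ _ =>
          sum_sq_sqrt_adaptiveProb_sub_le (a σ) (a (flip k σ)) (ha _) (ha _)
      have h3 := sum_flip k fun σ => ∑ y, p σ y * r k σ y
      simp_rw [hrflip] at h3
      simp_rw [add_div, add_mul, div_mul_eq_mul_div, Finset.sum_add_distrib, ← Finset.sum_div] at h2
      linarith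
    calc ∑ σ, ∑ k, H k σ = ∑ k, ∑ σ, H k σ := Finset.sum_comm
      _ ≤ ∑ k, ∑ σ, ∑ y, p σ y * r k σ y := Finset.sum_le_sum fun k _ => h1 k
      _ = ∑ σ, ∑ y, p σ y * ∑ k, r k σ y := by
          rw [Finset.sum_comm]
          refine Finset.sum_congr rfl fun σ _ => ?_
          rw [Finset.sum_comm]
          exact Finset.sum_congr rfl fun y _ => (Finset.mul_sum _ _ _).symm
      _ ≤ ∑ σ, ∑ y, p σ y * (n * ε) := by
          refine Finset.sum_le_sum fun σ _ => Finset.sum_le_sum fun y _ =>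
            mul_le_mul_of_nonneg_left ?_ (hp0 σ y)
          simp only [hr]
          rw [Finset.sum_comm]
          refine (Finset.sum_le_sum fun t _ => hε σ t _).trans ?_
          simp
      _ = 2 ^ Fintype.card κ * (n * ε) := by
          simp_rw [← Finset.sum_mul, hp1]
          simp
  -- Two neighbouring vertices cannot both be decided cheaply.
  have hpair : ∀ k, v / 2 * ∑ σ, (1 / 2 - H k σ / 2) ≤ ∑ σ, ∑ y, p σ y * cost y k (σ k) := by
    intro k
    have h1 := sum_flip k fun σ => ∑ y, p σ y * cost y k (σ k)
    have h2 : ∀ σ, v * (1 / 2 - H k σ / 2) ≤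
        ∑ y, p σ y * cost y k (σ k) + ∑ y, p (flip k σ) y * cost y k (flip k σ k) := by
      intro σ
      have h3 : ∑ y, ((p σ y + p (flip k σ) y) / 4 - (√(p σ y) - √(p (flip k σ) y)) ^ 2 / 2) =
          1 / 2 - H k σ / 2 := by
        rw [Finset.sum_sub_distrib, ← Finset.sum_div, Finset.sum_add_distrib, hp1, hp1,
          ← Finset.sum_div, show ∑ y, (√(p σ y) - √(p (flip k σ) y)) ^ 2 = H k σ from rfl]
        norm_num
      rw [← h3, Finset.mul_sum, ← Finset.sum_add_distrib]
      refine Finset.sum_le_sum fun y _ => ?_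
      refine (mul_le_mul_of_nonneg_left (min_ge_sub_sq_sqrt (hp0 _ _) (hp0 _ _)) hv0).trans ?_
      rw [flip_apply_self]
      have hmin : 0 ≤ min (p σ y) (p (flip k σ) y) := le_min (hp0 _ _) (hp0 _ _)
      have hc : v ≤ cost y k (σ k) + cost y k (!σ k) := by
        cases σ k
        · simpa [add_comm] using hv y k
        · simpa using hv y k
      calc v * min (p σ y) (p (flip k σ) y)
          ≤ (cost y k (σ k) + cost y k (!σ k)) * min (p σ y) (p (flip k σ) y) :=
            mul_le_mul_of_nonneg_right hc hmin
        _ = min (p σ y) (p (flip k σ) y) * cost y k (σ k) +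
            min (p σ y) (p (flip k σ) y) * cost y k (!σ k) := by ring
        _ ≤ _ := add_le_add (mul_le_mul_of_nonneg_right (min_le_left _ _) (hcost _ _ _))
            (mul_le_mul_of_nonneg_right (min_le_right _ _) (hcost _ _ _))
    have h4 := Finset.sum_le_sum fun σ (_ : σ ∈ Finset.univ) => h2 σ
    rw [← Finset.mul_sum, Finset.sum_add_distrib, h1] at h4
    linarith
  calc 2 ^ Fintype.card κ * (v / 4 * (Fintype.card κ - n * ε))
      = v / 4 * (2 ^ Fintype.card κ * Fintype.card κ - 2 ^ Fintype.card κ * (n * ε)) := by ring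
    _ ≤ v / 4 * (2 ^ Fintype.card κ * Fintype.card κ - ∑ σ, ∑ k, H k σ) :=
        mul_le_mul_of_nonneg_left (by linarith) (by linarith)
    _ = ∑ k, v / 2 * ∑ σ, (1 / 2 - H k σ / 2) := by
        rw [← Finset.mul_sum, Finset.sum_comm]
        simp_rw [Finset.sum_sub_distrib, ← Finset.sum_div]
        simp
        ring
    _ ≤ ∑ k, ∑ σ, ∑ y, p σ y * cost y k (σ k) := Finset.sum_le_sum fun k _ => hpair k
    _ = ∑ σ, ∑ y, p σ y * ∑ k, cost y k (σ k) := by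
        rw [Finset.sum_comm]
        refine Finset.sum_congr rfl fun σ _ => ?_
        rw [Finset.sum_comm]
        exact Finset.sum_congr rfl fun y _ => (Finset.mul_sum _ _ _).symm

/-! ### Bumps constant along the first coordinate -/

/-- A smooth bump on `ℝ^e` with the sup norm, equal to `1` on the closed ball of radius `1/4` and
vanishing outside the ball of radius `1/3`. The radius `1/3 < 1/2` separates the supports of its
translates by distinct integer vectors. -/
noncomputable def bump (e : ℕ) : ContDiffBump (0 : Fin e → ℝ) where
  rIn := 1 / 4
  rOut := 1 / 3
  rIn_pos := by norm_num
  rIn_lt_rOut := by norm_num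

/-- The map `ℝ^(e+1) → ℝ^e` that drops the first coordinate. -/
noncomputable def tail (e : ℕ) : Feature (e + 1) →L[ℝ] (Fin e → ℝ) :=
  ContinuousLinearMap.pi fun i => EuclideanSpace.proj i.succ

lemma norm_tail_le (e : ℕ) : ‖tail e‖ ≤ 1 := by
  refine ContinuousLinearMap.opNorm_le_bound _ zero_le_one fun x => ?_
  rw [one_mul, pi_norm_le_iff_of_nonneg (norm_nonneg _)]
  exact fun i => PiLp.norm_apply_le x i.succ

/-- The center of the cell `∏ [k i, k i + 1]`. -/
noncomputable def cellCenter {e m : ℕ} (k : Fin e → Fin m) : Fin e → ℝ := fun i => (k i : ℝ) + 1 / 2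

lemma cell_unique {e m : ℕ} {k k' : Fin e → Fin m} {z : Fin e → ℝ}
    (h : ‖z - cellCenter k‖ < 1 / 2) (h' : ‖z - cellCenter k'‖ < 1 / 2) : k = k' := by
  funext i
  have h1 := abs_lt.1 ((norm_le_pi_norm (z - cellCenter k) i).trans_lt h)
  have h2 := abs_lt.1 ((norm_le_pi_norm (z - cellCenter k') i).trans_lt h')
  simp only [Pi.sub_apply, cellCenter] at h1 h2
  have h3 : ((k i : ℕ) : ℝ) < (k' i : ℕ) + 1 := by linarith
  have h4 : ((k' i : ℕ) : ℝ) < (k i : ℕ) + 1 := by linarith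
  have h5 : (k i : ℕ) < (k' i : ℕ) + 1 := by exact_mod_cast h3
  have h6 : (k' i : ℕ) < (k i : ℕ) + 1 := by exact_mod_cast h4
  exact Fin.ext (by omega)

/-- The bump of the tube `ℝ × (k + [0,1]^e)/m`; it does not depend on the first coordinate. -/
noncomputable def tubeBump {e m : ℕ} (k : Fin e → Fin m) (x : Feature (e + 1)) : ℝ :=
  bump e ((m : ℝ) • tail e x - cellCenter k)

lemma tubeBump_mem {e m : ℕ} (k : Fin e → Fin m) (x : Feature (e + 1)) :
    tubeBump k x ∈ Set.Icc (0 : ℝ) 1 := ⟨(bump e).nonneg, (bump e).le_one⟩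

lemma tubeBump_eq_zero {e m : ℕ} {k : Fin e → Fin m} {x : Feature (e + 1)}
    (h : 1 / 3 < ‖(m : ℝ) • tail e x - cellCenter k‖) : tubeBump k x = 0 :=
  (bump e).zero_of_le_dist (by rw [dist_zero_right]; exact h.le)

lemma tubeBump_eq_one {e m : ℕ} {k : Fin e → Fin m} {x : Feature (e + 1)}
    (h : ‖(m : ℝ) • tail e x - cellCenter k‖ ≤ 1 / 4) : tubeBump k x = 1 :=
  (bump e).one_of_mem_closedBall (by rw [mem_closedBall_zero_iff]; exact h)

lemma contDiff_tubeBump {e m : ℕ} (k : Fin e → Fin m) (j : ℕ) : ContDiff ℝ j (tubeBump k) := by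
  unfold tubeBump
  have h : ContDiff ℝ j (bump e) := (bump e).contDiff
  exact h.comp (((tail e).contDiff.const_smul (m : ℝ)).sub contDiff_const)

lemma norm_iteratedFDeriv_comp_clm_le {E F : Type*} [NormedAddCommGroup E] [NormedSpace ℝ E]
    [NormedAddCommGroup F] [NormedSpace ℝ F] {f : F → ℝ} {j : ℕ} (hf : ContDiff ℝ j f)
    (g : E →L[ℝ] F) (x : E) :
    ‖iteratedFDeriv ℝ j (f ∘ g) x‖ ≤ ‖iteratedFDeriv ℝ j f (g x)‖ * ‖g‖ ^ j := by
  rw [g.iteratedFDeriv_comp_right hf x le_rfl]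
  refine (ContinuousMultilinearMap.norm_compContinuousLinearMap_le _ _).trans ?_
  simp

lemma exists_norm_iteratedFDeriv_bump_le (e j : ℕ) :
    ∃ M : ℝ, ∀ z, ‖iteratedFDeriv ℝ j (bump e) z‖ ≤ M := by
  have h : ContDiff ℝ j (bump e) := (bump e).contDiff
  exact ((bump e).hasCompactSupport.iteratedFDeriv j).exists_bound_of_continuous
    (h.continuous_iteratedFDeriv le_rfl)

lemma norm_iteratedFDeriv_tubeBump_le {e m : ℕ} (k : Fin e → Fin m) (j : ℕ)
    (x : Feature (e + 1)) : ‖iteratedFDeriv ℝ j (tubeBump k) x‖ ≤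
      ‖iteratedFDeriv ℝ j (bump e) ((m : ℝ) • tail e x - cellCenter k)‖ * (m : ℝ) ^ j := by
  have h0 : ContDiff ℝ j (bump e) := (bump e).contDiff
  have h1 : ContDiff ℝ j (fun z => bump e (z - cellCenter k)) :=
    h0.comp (contDiff_id.sub contDiff_const)
  have h2 := norm_iteratedFDeriv_comp_clm_le h1 ((m : ℝ) • tail e) x
  rw [iteratedFDeriv_comp_sub] at h2
  refine h2.trans (mul_le_mul_of_nonneg_left ?_ (norm_nonneg _))
  refine pow_le_pow_left₀ (norm_nonneg _) ?_ j
  rw [norm_smul, Real.norm_natCast]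
  exact mul_le_of_le_one_right (Nat.cast_nonneg m) (norm_tail_le e)

lemma iteratedFDeriv_tubeBump_eq_zero {e m : ℕ} {k : Fin e → Fin m} (j : ℕ) {x : Feature (e + 1)}
    (h : 1 / 3 < ‖(m : ℝ) • tail e x - cellCenter k‖) :
    iteratedFDeriv ℝ j (tubeBump k) x = 0 := by
  have h1 : iteratedFDeriv ℝ j (bump e) ((m : ℝ) • tail e x - cellCenter k) = 0 := by
    by_contra hne
    have h2 := support_iteratedFDeriv_subset j hne
    rw [(bump e).tsupport_eq, mem_closedBall_zero_iff] at h2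
    exact absurd h2 (not_le.2 h)
  have h3 := norm_iteratedFDeriv_tubeBump_le k j x
  rw [h1, norm_zero, zero_mul] at h3
  exact norm_le_zero_iff.1 h3

/-- `±1` according to the Boolean. -/
def sign (b : Bool) : ℝ := if b then 1 else -1

lemma abs_sign (b : Bool) : |sign b| = 1 := by cases b <;> simp [sign]

/-- The sum of all tube bumps with the signs prescribed by `σ`. -/
noncomputable def signedBumps {e m : ℕ} (σ : (Fin e → Fin m) → Bool) (x : Feature (e + 1)) : ℝ :=
  ∑ k, sign (σ k) * tubeBump k x

/-- Tubes being disjoint, a sum over all tubes of quantities that vanish off their tube is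
bounded by the bound for one quantity. -/
lemma norm_sum_tubes_le {e m : ℕ} {V : Type*} [SeminormedAddCommGroup V] (z : Fin e → ℝ)
    (g : (Fin e → Fin m) → V) {B : ℝ} (hB : 0 ≤ B) (hg : ∀ k, ‖g k‖ ≤ B)
    (h0 : ∀ k, 1 / 3 < ‖z - cellCenter k‖ → g k = 0) : ‖∑ k, g k‖ ≤ B := by
  by_cases h : ∃ k : Fin e → Fin m, ‖z - cellCenter k‖ ≤ 1 / 3
  · obtain ⟨k, hk⟩ := h
    rw [Finset.sum_eq_single k]
    · exact hg k
    · intro k' _ hne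
      refine h0 k' (not_le.1 fun h' => hne ?_)
      exact cell_unique (h'.trans_lt (by norm_num)) (hk.trans_lt (by norm_num))
    · simp
  · push Not at h
    rw [Finset.sum_eq_zero fun k _ => h0 k (h k), norm_zero]
    exact hB

lemma abs_signedBumps_le {e m : ℕ} (σ : (Fin e → Fin m) → Bool) (x : Feature (e + 1)) :
    |signedBumps σ x| ≤ 1 := by
  rw [← Real.norm_eq_abs]
  refine norm_sum_tubes_le ((m : ℝ) • tail e x) _ zero_le_one (fun k => ?_) fun k hk => ?_
  · rw [norm_mul, Real.norm_eq_abs, abs_sign, one_mul, Real.norm_eq_abs,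
      abs_of_nonneg (tubeBump_mem k x).1]
    exact (tubeBump_mem k x).2
  · rw [tubeBump_eq_zero hk, mul_zero]

lemma contDiff_signedBumps {e m : ℕ} (σ : (Fin e → Fin m) → Bool) (j : ℕ) :
    ContDiff ℝ j (signedBumps σ) :=
  ContDiff.sum fun k _ => contDiff_const.mul (contDiff_tubeBump k j)

lemma norm_iteratedFDeriv_signedBumps_le {e m : ℕ} (σ : (Fin e → Fin m) → Bool) {j : ℕ} {M : ℝ}
    (hM : ∀ z, ‖iteratedFDeriv ℝ j (bump e) z‖ ≤ M) (x : Feature (e + 1)) :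
    ‖iteratedFDeriv ℝ j (signedBumps σ) x‖ ≤ M * (m : ℝ) ^ j := by
  have hM0 : 0 ≤ M := (norm_nonneg _).trans (hM 0)
  have h1 : iteratedFDeriv ℝ j (signedBumps σ) x =
      ∑ k, sign (σ k) • iteratedFDeriv ℝ j (tubeBump k) x := by
    have h2 : signedBumps σ = fun x => ∑ k, (sign (σ k) • tubeBump k) x := rfl
    have h3 : ∀ k ∈ Finset.univ, ContDiff ℝ j (sign (σ k) • tubeBump k) := fun k _ =>
      (contDiff_tubeBump k j).const_smul (sign (σ k))
    rw [h2, iteratedFDeriv_sum h3, Finset.sum_apply]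
    exact Finset.sum_congr rfl fun k _ =>
      iteratedFDeriv_const_smul_apply (contDiff_tubeBump k j).contDiffAt
  rw [h1]
  refine norm_sum_tubes_le ((m : ℝ) • tail e x) _ (by positivity) (fun k => ?_) fun k hk => ?_
  · rw [norm_smul, Real.norm_eq_abs, abs_sign, one_mul]
    exact (norm_iteratedFDeriv_tubeBump_le k j x).trans
      (mul_le_mul_of_nonneg_right (hM _) (by positivity))
  · rw [iteratedFDeriv_tubeBump_eq_zero j hk, smul_zero]

/-! ### The regression functions -/

/-- A bounded smooth function that increases along the first coordinate in the unit cube and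
vanishes at the hyperplane `x 0 = 1/2`. -/
noncomputable def slope {e : ℕ} (x : Feature (e + 1)) : ℝ := 1 / 4 * Real.sin (x 0 - 1 / 2)

lemma abs_iteratedDeriv_sin_cos_le (j : ℕ) :
    (∀ t, |iteratedDeriv j Real.sin t| ≤ 1) ∧ (∀ t, |iteratedDeriv j Real.cos t| ≤ 1) := by
  induction j with
  | zero => simpa using ⟨Real.abs_sin_le_one, Real.abs_cos_le_one⟩
  | succ j ih =>
    refine ⟨fun t => ?_, fun t => ?_⟩
    · rw [Real.iteratedDeriv_add_one_sin]; exact ih.2 t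
    · rw [Real.iteratedDeriv_add_one_cos, Pi.neg_apply, abs_neg]; exact ih.1 t

lemma contDiff_slope {e : ℕ} (j : ℕ) : ContDiff ℝ j (slope (e := e)) := by
  have h : ContDiff ℝ j (fun x : Feature (e + 1) => x 0) :=
    (EuclideanSpace.proj (𝕜 := ℝ) (0 : Fin (e + 1))).contDiff
  unfold slope
  exact contDiff_const.mul (Real.contDiff_sin.comp (h.sub contDiff_const))

lemma norm_iteratedFDeriv_slope_le {e : ℕ} (j : ℕ) (x : Feature (e + 1)) :
    ‖iteratedFDeriv ℝ j slope x‖ ≤ 1 := by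
  have hs : ContDiff ℝ j (fun t => Real.sin (t - 1 / 2)) :=
    Real.contDiff_sin.comp (contDiff_id.sub contDiff_const)
  set g : Feature (e + 1) →L[ℝ] ℝ := EuclideanSpace.proj 0 with hg
  have h1 := norm_iteratedFDeriv_comp_clm_le hs g x
  rw [iteratedFDeriv_comp_sub, norm_iteratedFDeriv_eq_norm_iteratedDeriv] at h1
  have h2 : slope = (1 / 4 : ℝ) • ((fun t => Real.sin (t - 1 / 2)) ∘ g) := rfl
  have h3 : ‖g‖ ≤ 1 := by
    refine ContinuousLinearMap.opNorm_le_bound _ zero_le_one fun y => ?_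
    rw [one_mul]
    exact PiLp.norm_apply_le y 0
  rw [h2, iteratedFDeriv_const_smul_apply (hs.comp g.contDiff).contDiffAt, norm_smul]
  have h4 : ‖g‖ ^ j ≤ 1 := pow_le_one₀ (norm_nonneg _) h3
  have h5 := (abs_iteratedDeriv_sin_cos_le j).1 (g x - 1 / 2)
  rw [← Real.norm_eq_abs] at h5
  have h6 := h1.trans (mul_le_mul h5 h4 (by positivity) zero_le_one)
  rw [Real.norm_eq_abs, abs_of_pos (by norm_num)]
  linarith

/-- The regression function of the vertex `σ`: bumps of height `δ` move the decision boundary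
`x 0 = 1/2` up or down within the tubes. -/
noncomputable def regression {e m : ℕ} (δ : ℝ) (σ : (Fin e → Fin m) → Bool)
    (x : Feature (e + 1)) : ℝ :=
  1 / 2 + (slope x + δ * signedBumps σ x)

lemma regression_mem {e m : ℕ} {δ : ℝ} (hδ : 0 ≤ δ) (hδ' : δ ≤ 1 / 8)
    (σ : (Fin e → Fin m) → Bool) (x : Feature (e + 1)) :
    regression δ σ x ∈ Set.Icc (1 / 8 : ℝ) (7 / 8) := by
  have h1 := abs_le.1 (Real.abs_sin_le_one (x 0 - 1 / 2))
  have h2 := abs_le.1 (abs_signedBumps_le σ x)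
  unfold regression slope
  constructor <;> nlinarith

lemma contDiff_regression {e m : ℕ} (δ : ℝ) (σ : (Fin e → Fin m) → Bool) (j : ℕ) :
    ContDiff ℝ j (regression δ σ) :=
  contDiff_const.add ((contDiff_slope j).add (contDiff_const.mul (contDiff_signedBumps σ j)))

lemma measurable_regression {e m : ℕ} (δ : ℝ) (σ : (Fin e → Fin m) → Bool) :
    Measurable (regression δ σ) := (contDiff_regression δ σ 0).continuous.measurable

/-! ### Hölder smoothness -/

/-- Interpolation: a function oscillating at the scale `1/m` with derivatives of order `r` and
`r + 1` of size `m ^ (r - α)` and `m ^ (r + 1 - α)` has an `(α - r)`-Hölder `r`-th derivative,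
with a constant that does not depend on `m`. -/
lemma norm_iteratedFDeriv_sub_le {E : Type*} [NormedAddCommGroup E] [NormedSpace ℝ E]
    {u : E → ℝ} {r : ℕ} {α A m : ℝ} (hα : (r : ℝ) ≤ α) (hα' : α < r + 1) (hm : 0 < m)
    (hA : 0 ≤ A) (hu : ContDiff ℝ (r + 1 : ℕ) u)
    (h1 : ∀ x, ‖iteratedFDeriv ℝ r u x‖ ≤ A * m ^ ((r : ℝ) - α))
    (h2 : ∀ x, ‖iteratedFDeriv ℝ (r + 1) u x‖ ≤ A * m ^ ((r : ℝ) + 1 - α)) (x y : E) :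
    ‖iteratedFDeriv ℝ r u x - iteratedFDeriv ℝ r u y‖ ≤ 2 * A * ‖x - y‖ ^ (α - r) := by
  rcases le_total 1 (m * ‖x - y‖) with h | h
  · have h3 : m ^ ((r : ℝ) - α) ≤ ‖x - y‖ ^ (α - r) := by
      rw [← neg_sub α, Real.rpow_neg hm.le, ← Real.inv_rpow hm.le]
      refine Real.rpow_le_rpow (by positivity) ?_ (by linarith)
      rwa [inv_le_iff_one_le_mul₀' hm]
    calc _ ≤ ‖iteratedFDeriv ℝ r u x‖ + ‖iteratedFDeriv ℝ r u y‖ := norm_sub_le _ _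
      _ ≤ 2 * A * m ^ ((r : ℝ) - α) := by linarith [h1 x, h1 y]
      _ ≤ _ := mul_le_mul_of_nonneg_left h3 (by positivity)
  · have h3 : m ^ ((r : ℝ) + 1 - α) * ‖x - y‖ ≤ ‖x - y‖ ^ (α - r) := by
      rcases (norm_nonneg (x - y)).eq_or_lt with h0 | h0
      · rw [← h0, mul_zero]; exact Real.rpow_nonneg le_rfl _
      · have h4 : (m * ‖x - y‖) ^ ((r : ℝ) + 1 - α) ≤ 1 :=
          Real.rpow_le_one (by positivity) h (by linarith)
        have h5 : ‖x - y‖ = ‖x - y‖ ^ ((r : ℝ) + 1 - α) * ‖x - y‖ ^ (α - r) := by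
          rw [← Real.rpow_add h0]; simp
        calc m ^ ((r : ℝ) + 1 - α) * ‖x - y‖
            = (m * ‖x - y‖) ^ ((r : ℝ) + 1 - α) * ‖x - y‖ ^ (α - r) := by
              rw [Real.mul_rpow hm.le h0.le, mul_assoc, ← h5]
          _ ≤ _ := mul_le_of_le_one_left (by positivity) h4
    have h4 : ‖iteratedFDeriv ℝ r u x - iteratedFDeriv ℝ r u y‖ ≤
        A * m ^ ((r : ℝ) + 1 - α) * ‖x - y‖ := by
      refine Convex.norm_image_sub_le_of_norm_fderiv_le (𝕜 := ℝ) (s := Set.univ)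
        (fun z _ => ?_) (fun z _ => ?_) convex_univ (Set.mem_univ _) (Set.mem_univ _)
      · exact hu.differentiable_iteratedFDeriv (by exact_mod_cast Nat.lt_succ_self r) z
      · rw [norm_fderiv_iteratedFDeriv]; exact h2 z
    calc _ ≤ A * m ^ ((r : ℝ) + 1 - α) * ‖x - y‖ := h4
      _ = A * (m ^ ((r : ℝ) + 1 - α) * ‖x - y‖) := by ring
      _ ≤ A * ‖x - y‖ ^ (α - r) := mul_le_mul_of_nonneg_left h3 hA
      _ ≤ _ := by
        have : 0 ≤ A * ‖x - y‖ ^ (α - r) := by positivity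
        linarith

lemma sumMultiIndex_le {d : ℕ} (j : ℕ)
    (T : ContinuousMultilinearMap ℝ (fun _ : Fin j => Feature d) ℝ) :
    sumMultiIndex j (fun v => T v) ≤ (d : ℝ) ^ j * ‖T‖ := by
  classical
  unfold sumMultiIndex
  refine (Finset.sum_le_card_nsmul _ _ ‖T‖ fun i _ => ?_).trans ?_
  · refine (T.le_opNorm _).trans ?_
    simp
  · rw [nsmul_eq_mul]
    refine mul_le_mul_of_nonneg_right ?_ (norm_nonneg _)
    calc ((Finset.univ.card : ℕ) : ℝ) ≤ (Fintype.card (Fin j → Fin d) : ℕ) := by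
          exact_mod_cast Fintype.card_subtype_le fun i : Fin j → Fin d => Monotone i
      _ = (d : ℝ) ^ j := by simp

/-- With bumps of height `m ^ (-α) / 8` at scale `1/m`, all regression functions lie in one Hölder
class, whose constant depends on `α` and the dimension only. -/
lemma exists_isHolder_regression (e : ℕ) {α : ℝ} (hα : 0 < α) :
    ∃ lam₀ : ℝ, 1 ≤ lam₀ ∧ ∀ lam, lam₀ ≤ lam → ∀ m : ℕ, 1 ≤ m →
      ∀ σ : (Fin e → Fin m) → Bool, IsHolder lam α (regression ((m : ℝ) ^ (-α) / 8) σ) := by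
  choose M hM using exists_norm_iteratedFDeriv_bump_le e
  have hM0 : ∀ j, 0 ≤ M j := fun j => (norm_nonneg _).trans (hM j 0)
  set r := ⌊α⌋₊ with hr
  have hrα : (r : ℝ) ≤ α := Nat.floor_le hα.le
  have hrα' : α < r + 1 := Nat.lt_floor_add_one α
  set A : ℝ := ∑ j ∈ Finset.range (r + 2), M j with hA
  have hA0 : 0 ≤ A := Finset.sum_nonneg fun j _ => hM0 j
  have hMA : ∀ j, j ≤ r + 1 → M j ≤ A := fun j hj =>
    Finset.single_le_sum (f := M) (fun i _ => hM0 i) (Finset.mem_range.2 (by omega))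
  have hd1 : (1 : ℝ) ≤ ((e + 1 : ℕ) : ℝ) := by norm_cast; omega
  -- There are at most `d ^ r` multi-indices. In `2 + 2 * A` the bumps contribute `2 * A`, and the
  -- slope together with the constant `1/2` contributes `2`.
  refine ⟨((e + 1 : ℕ) : ℝ) ^ r * (2 + 2 * A), ?_, fun lam hlam m hm σ => ?_⟩
  · nlinarith [one_le_pow₀ hd1 (n := r)]
  have hm1 : (1 : ℝ) ≤ m := by exact_mod_cast hm
  have hm0 : (0 : ℝ) < m := by linarith
  set δ : ℝ := (m : ℝ) ^ (-α) / 8 with hδdef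
  have hpow1 : (m : ℝ) ^ (-α) ≤ 1 := Real.rpow_le_one_of_one_le_of_nonpos hm1 (by linarith)
  have hδ0 : 0 ≤ δ := by positivity
  have hδ1 : δ ≤ 1 / 8 := by linarith
  set w : Feature (e + 1) → ℝ := δ • signedBumps σ with hw
  have hwc : ∀ j : ℕ, ContDiff ℝ j w := fun j => (contDiff_signedBumps σ j).const_smul δ
  have hwb : ∀ j : ℕ, j ≤ r + 1 → ∀ x, ‖iteratedFDeriv ℝ j w x‖ ≤ A * (m : ℝ) ^ ((j : ℝ) - α) := by
    intro j hj x
    rw [hw, iteratedFDeriv_const_smul_apply (contDiff_signedBumps σ j).contDiffAt, norm_smul,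
      Real.norm_eq_abs, abs_of_nonneg hδ0]
    have h1 := norm_iteratedFDeriv_signedBumps_le σ (hM j) x
    have h2 : (m : ℝ) ^ ((j : ℝ) - α) = (m : ℝ) ^ j * (m : ℝ) ^ (-α) := by
      rw [sub_eq_add_neg, Real.rpow_add hm0, Real.rpow_natCast]
    have h3 : (0 : ℝ) ≤ (m : ℝ) ^ (-α) := by positivity
    have h4 : (0 : ℝ) ≤ (m : ℝ) ^ j * (m : ℝ) ^ (-α) := by positivity
    rw [h2]
    calc δ * _ ≤ δ * (M j * (m : ℝ) ^ j) := mul_le_mul_of_nonneg_left h1 hδ0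
      _ = M j * ((m : ℝ) ^ j * (m : ℝ) ^ (-α)) / 8 := by rw [hδdef]; ring
      _ ≤ A * ((m : ℝ) ^ j * (m : ℝ) ^ (-α)) / 8 := by
          have := mul_le_mul_of_nonneg_right (hMA j hj) h4
          linarith
      _ ≤ _ := by
          have := mul_nonneg hA0 h4
          linarith
  have hsplit : ∀ (j : ℕ) x, iteratedFDeriv ℝ j (regression δ σ) x =
      iteratedFDeriv ℝ j (fun _ : Feature (e + 1) => (1 / 2 : ℝ)) x +
        (iteratedFDeriv ℝ j slope x + iteratedFDeriv ℝ j w x) := by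
    intro j x
    have h1 : regression δ σ = (fun _ => (1 / 2 : ℝ)) + (slope + w) := rfl
    have h2 : ContDiff ℝ j (slope + w) := (contDiff_slope j).add (hwc j)
    rw [h1, iteratedFDeriv_add_apply contDiff_const.contDiffAt h2.contDiffAt,
      iteratedFDeriv_add_apply (contDiff_slope j).contDiffAt (hwc j).contDiffAt]
  have hconst : ∀ (j : ℕ) (x : Feature (e + 1)),
      ‖iteratedFDeriv ℝ j (fun _ : Feature (e + 1) => (1 / 2 : ℝ)) x‖ ≤ 1 := by
    intro j x
    rcases Nat.eq_zero_or_pos j with rfl | hj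
    · rw [norm_iteratedFDeriv_zero]; norm_num
    · rw [iteratedFDeriv_const_of_ne hj.ne']; simp
  refine ⟨fun x => ?_, contDiff_regression δ σ r, fun j hj x => ?_, fun x y => ?_⟩
  · have := regression_mem hδ0 hδ1 σ x
    exact ⟨by linarith [this.1], by linarith [this.2]⟩
  · have hjr : j ≤ r := Nat.le_floor hj
    refine (sumMultiIndex_le j (iteratedFDeriv ℝ j (regression δ σ) x)).trans (le_trans ?_ hlam)
    have h1 : ‖iteratedFDeriv ℝ j (regression δ σ) x‖ ≤ 2 + 2 * A := by
      rw [hsplit]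
      have h2 : (m : ℝ) ^ ((j : ℝ) - α) ≤ 1 :=
        Real.rpow_le_one_of_one_le_of_nonpos hm1 (by linarith)
      have h3 := (hwb j (by omega) x).trans (mul_le_of_le_one_right hA0 h2)
      have h4 := norm_iteratedFDeriv_slope_le j x
      have h5 := hconst j x
      refine (norm_add_le _ _).trans ?_
      have h6 := norm_add_le (iteratedFDeriv ℝ j slope x) (iteratedFDeriv ℝ j w x)
      linarith
    exact mul_le_mul (pow_le_pow_right₀ hd1 hjr) h1 (norm_nonneg _) (by positivity)
  · refine (sumMultiIndex_le r
      (iteratedFDeriv ℝ r (regression δ σ) x - iteratedFDeriv ℝ r (regression δ σ) y)).trans ?_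
    have h0 : iteratedFDeriv ℝ r (fun _ : Feature (e + 1) => (1 / 2 : ℝ)) x =
        iteratedFDeriv ℝ r (fun _ : Feature (e + 1) => (1 / 2 : ℝ)) y := by
      rcases Nat.eq_zero_or_pos r with h | h
      · rw [h]; rfl
      · rw [iteratedFDeriv_const_of_ne h.ne']; rfl
    have h1 := norm_iteratedFDeriv_sub_le hrα hrα' one_pos zero_le_one
      (contDiff_slope (e := e) (r + 1)) (by simpa using norm_iteratedFDeriv_slope_le r)
      (by simpa using norm_iteratedFDeriv_slope_le (r + 1)) x y
    have h2 := norm_iteratedFDeriv_sub_le hrα hrα' hm0 hA0 (hwc (r + 1)) (hwb r (by omega))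
      (by simpa using hwb (r + 1) le_rfl) x y
    have h3 : ‖iteratedFDeriv ℝ r (regression δ σ) x - iteratedFDeriv ℝ r (regression δ σ) y‖ ≤
        (2 + 2 * A) * ‖x - y‖ ^ (α - r) := by
      rw [hsplit, hsplit, h0, add_sub_add_left_eq_sub, add_sub_add_comm]
      refine (norm_add_le _ _).trans ?_
      linarith
    calc _ ≤ ((e + 1 : ℕ) : ℝ) ^ r * ((2 + 2 * A) * ‖x - y‖ ^ (α - r)) :=
          mul_le_mul_of_nonneg_left h3 (by positivity)
      _ = ((e + 1 : ℕ) : ℝ) ^ r * (2 + 2 * A) * ‖x - y‖ ^ (α - r) := by ring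
      _ ≤ _ := mul_le_mul_of_nonneg_right hlam (by positivity)

/-! ### The uniform law on the unit cube -/

/-- The uniform law on `[0,1]^d`. -/
noncomputable def uniformLaw (d : ℕ) : Measure (Feature d) := volume.restrict (unitCube d)

lemma unitCube_eq_preimage (d : ℕ) :
    unitCube d = WithLp.ofLp ⁻¹' (Set.Icc (0 : Fin d → ℝ) 1) := by
  ext x
  simp [unitCube, Pi.le_def, forall_and]

lemma measurableSet_unitCube (d : ℕ) : MeasurableSet (unitCube d) := by
  rw [unitCube_eq_preimage]
  exact (PiLp.volume_preserving_ofLp (Fin d)).measurable measurableSet_Icc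

lemma volume_unitCube (d : ℕ) : volume (unitCube d) = 1 := by
  rw [unitCube_eq_preimage,
    (PiLp.volume_preserving_ofLp (Fin d)).measure_preimage measurableSet_Icc.nullMeasurableSet,
    Real.volume_Icc_pi]
  simp

instance (d : ℕ) : IsProbabilityMeasure (uniformLaw d) :=
  ⟨by rw [uniformLaw, Measure.restrict_apply_univ, volume_unitCube]⟩

lemma strongDensity_uniformLaw (d : ℕ) {c₁ : ℝ} (hc₁ : c₁ ≤ 1) :
    StrongDensity (uniformLaw d) c₁ := by
  intro l k _
  have h2 : (0 : ℝ) < 2 ^ l := by positivity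
  set B : Set (Fin d → ℝ) := Set.univ.pi fun i =>
    Set.Ico (((k i : ℕ) : ℝ) / 2 ^ l) ((((k i : ℕ) : ℝ) + 1) / 2 ^ l) with hB
  have hBm : MeasurableSet B := MeasurableSet.univ_pi fun i => measurableSet_Ico
  have hvol : volume B = ENNReal.ofReal (((2 : ℝ) ^ (l * d))⁻¹) := by
    rw [hB, Real.volume_pi_Ico]
    have h3 : ∀ i, (((k i : ℕ) : ℝ) + 1) / 2 ^ l - ((k i : ℕ) : ℝ) / 2 ^ l = ((2 : ℝ) ^ l)⁻¹ :=
      fun i => by ring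
    simp_rw [h3]
    rw [Finset.prod_const, Finset.card_univ, Fintype.card_fin,
      ← ENNReal.ofReal_pow (by positivity), inv_pow, pow_mul]
  have hsub : WithLp.ofLp ⁻¹' B ⊆ dyadicCell d l k ∩ unitCube d := by
    intro x hx
    have hx' : ∀ i, ((k i : ℕ) : ℝ) / 2 ^ l ≤ x i ∧ x i < (((k i : ℕ) : ℝ) + 1) / 2 ^ l :=
      fun i => hx i (Set.mem_univ i)
    refine ⟨fun i => ⟨(hx' i).1, Or.inl (hx' i).2⟩, fun i => ⟨?_, ?_⟩⟩
    · exact le_trans (by positivity) (hx' i).1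
    · refine (hx' i).2.le.trans ?_
      rw [div_le_one h2]
      exact_mod_cast (k i).isLt
  have hle : ENNReal.ofReal (((2 : ℝ) ^ (l * d))⁻¹) ≤ uniformLaw d (dyadicCell d l k) := by
    rw [← hvol, ← (PiLp.volume_preserving_ofLp (Fin d)).measure_preimage hBm.nullMeasurableSet,
      uniformLaw, Measure.restrict_apply' (measurableSet_unitCube d)]
    exact measure_mono hsub
  have h4 : ((2 : ℝ) ^ (l * d))⁻¹ ≤ (uniformLaw d).real (dyadicCell d l k) := by
    rw [measureReal_def]
    exact (ENNReal.ofReal_le_iff_le_toReal (measure_ne_top _ _)).1 hle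
  exact (mul_le_of_le_one_left (by positivity) hc₁).trans h4

/-- Splitting off the first coordinate preserves volume. -/
lemma measurePreserving_split (e : ℕ) :
    MeasurePreserving (fun x : Feature (e + 1) => (x 0, tail e x)) volume volume := by
  have h := (volume_preserving_piFinSuccAbove (fun _ : Fin (e + 1) => ℝ) 0).comp
    (PiLp.volume_preserving_ofLp (Fin (e + 1)))
  exact h

/-! ### The margin condition -/

/-- The slope is at least `7/8` since `cos u ≥ 1 - u ^ 2 / 2` and `|u| ≤ 1/2`. -/
lemma mul_sub_le_sin_sub_sin {s t : ℝ} (hs : s ∈ Set.Icc (0 : ℝ) 1) (ht : t ∈ Set.Icc (0 : ℝ) 1)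
    (hst : s ≤ t) : 7 / 8 * (t - s) ≤ Real.sin (t - 1 / 2) - Real.sin (s - 1 / 2) := by
  have hmono : MonotoneOn (fun u => Real.sin u - 7 / 8 * u) (Set.Icc (-(1 / 2)) (1 / 2)) := by
    refine monotoneOn_of_deriv_nonneg (convex_Icc _ _) (by fun_prop) (by fun_prop) fun u hu => ?_
    rw [interior_Icc] at hu
    have hd : HasDerivAt (fun u => Real.sin u - 7 / 8 * u) (Real.cos u - 7 / 8 * 1) u :=
      (Real.hasDerivAt_sin u).sub ((hasDerivAt_id u).const_mul _)
    rw [hd.deriv]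
    have := Real.one_sub_sq_div_two_le_cos (x := u)
    nlinarith [hu.1, hu.2]
  have h := hmono (a := s - 1 / 2) (b := t - 1 / 2) ⟨by linarith [hs.1], by linarith [hs.2]⟩
    ⟨by linarith [ht.1], by linarith [ht.2]⟩ (by linarith)
  simp only at h
  linarith

lemma abs_sub_le_of_abs_sin_le {s t c Δ : ℝ} (hs : s ∈ Set.Icc (0 : ℝ) 1)
    (ht : t ∈ Set.Icc (0 : ℝ) 1) (hs' : |1 / 4 * Real.sin (s - 1 / 2) + c| ≤ Δ)
    (ht' : |1 / 4 * Real.sin (t - 1 / 2) + c| ≤ Δ) : |s - t| ≤ 10 * Δ := by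
  have hΔ : 0 ≤ Δ := (abs_nonneg _).trans hs'
  rw [abs_le] at hs' ht'
  rcases le_total s t with h | h
  · rw [abs_sub_comm, abs_of_nonneg (by linarith)]
    linarith [mul_sub_le_sin_sub_sin hs ht h]
  · rw [abs_of_nonneg (by linarith)]
    linarith [mul_sub_le_sin_sub_sin ht hs h]

/-- On every line in the direction of the first coordinate the regression function crosses `1/2`
with a slope bounded below, so that the margin condition holds with `β = 1`. -/
lemma uniformLaw_margin_le {e m : ℕ} (δ : ℝ) (σ : (Fin e → Fin m) → Bool) {Δ : ℝ} (hΔ : 0 ≤ Δ) :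
    (uniformLaw (e + 1)).real {x | |regression δ σ x - 1 / 2| ≤ Δ} ≤ 10 * Δ := by
  set g : (Fin e → ℝ) → ℝ :=
    fun z => δ * ∑ k, sign (σ k) * bump e ((m : ℝ) • z - cellCenter k) with hg
  have hgm : Continuous g := by
    refine continuous_const.mul (continuous_finsetSum _ fun k _ => continuous_const.mul ?_)
    exact (bump e).continuous.comp ((continuous_id.const_smul (m : ℝ)).sub continuous_const)
  set U : Set (ℝ × (Fin e → ℝ)) := {p | p.1 ∈ Set.Icc (0 : ℝ) 1 ∧
    p.2 ∈ Set.Icc (0 : Fin e → ℝ) 1 ∧ |1 / 4 * Real.sin (p.1 - 1 / 2) + g p.2| ≤ Δ} with hU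
  have hUm : MeasurableSet U := by
    refine IsClosed.measurableSet ?_
    refine (isClosed_Icc.preimage continuous_fst).inter
      ((isClosed_Icc.preimage continuous_snd).inter ?_)
    have h : Continuous fun p : ℝ × (Fin e → ℝ) => |1 / 4 * Real.sin (p.1 - 1 / 2) + g p.2| := by
      fun_prop
    exact isClosed_le h continuous_const
  have hslice : ∀ z, volume ((fun t => (t, z)) ⁻¹' U) ≤
      (Set.Icc (0 : Fin e → ℝ) 1).indicator (fun _ => ENNReal.ofReal (10 * Δ)) z := by
    intro z
    by_cases hz : z ∈ Set.Icc (0 : Fin e → ℝ) 1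
    · rw [Set.indicator_of_mem hz]
      refine (Real.volume_le_diam _).trans (Metric.ediam_le fun s hs t ht => ?_)
      rw [edist_dist, Real.dist_eq]
      exact ENNReal.ofReal_le_ofReal (abs_sub_le_of_abs_sin_le hs.1 ht.1 hs.2.2 ht.2.2)
    · have hempty : (fun t : ℝ => (t, z)) ⁻¹' U = ∅ :=
        Set.eq_empty_of_forall_notMem fun t ht => hz ht.2.1
      rw [hempty, measure_empty]
      exact zero_le
  have hvol : volume U ≤ ENNReal.ofReal (10 * Δ) := by
    rw [Measure.volume_eq_prod, Measure.prod_apply_symm hUm]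
    refine (lintegral_mono hslice).trans ?_
    rw [lintegral_indicator measurableSet_Icc, setLIntegral_const, Real.volume_Icc_pi]
    simp
  -- The perturbation `g` depends on the last coordinates only, so it is constant on every slice.
  have hsub : {x | |regression δ σ x - 1 / 2| ≤ Δ} ∩ unitCube (e + 1) ⊆
      (fun x : Feature (e + 1) => (x 0, tail e x)) ⁻¹' U := by
    rintro x ⟨hx, hx'⟩
    refine ⟨hx' 0, ⟨fun i => (hx' i.succ).1, fun i => (hx' i.succ).2⟩, ?_⟩
    have h : regression δ σ x - 1 / 2 = 1 / 4 * Real.sin (x 0 - 1 / 2) + g (tail e x) := by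
      rw [regression, add_sub_cancel_left]
      rfl
    rw [← h]
    exact hx
  rw [measureReal_def]
  refine ENNReal.toReal_le_of_le_ofReal (by linarith) ?_
  rw [uniformLaw, Measure.restrict_apply' (measurableSet_unitCube _)]
  refine (measure_mono hsub).trans ?_
  rw [(measurePreserving_split e).measure_preimage hUm.nullMeasurableSet]
  exact hvol

/-! ### The regions where neighbouring problems disagree -/

/-- The part of the tube `k` on which the Bayes classifier is determined by the sign of the
bump `k`. -/
def decisionRegion {e m : ℕ} (δ : ℝ) (k : Fin e → Fin m) : Set (Feature (e + 1)) :=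
  {x | |x 0 - 1 / 2| ≤ δ ∧ ‖(m : ℝ) • tail e x - cellCenter k‖ ≤ 1 / 4}

lemma measurableSet_decisionRegion {e m : ℕ} (δ : ℝ) (k : Fin e → Fin m) :
    MeasurableSet (decisionRegion δ k) := by
  refine IsClosed.measurableSet ?_
  have h0 : Continuous fun x : Feature (e + 1) => x 0 :=
    (EuclideanSpace.proj (𝕜 := ℝ) (0 : Fin (e + 1))).continuous
  refine IsClosed.inter (isClosed_le (h0.sub continuous_const).abs continuous_const) ?_
  exact isClosed_le (((tail e).continuous.const_smul (m : ℝ)).sub continuous_const).norm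
    continuous_const

lemma pairwise_disjoint_decisionRegion {e m : ℕ} (δ : ℝ) :
    Pairwise fun k k' : Fin e → Fin m => Disjoint (decisionRegion δ k) (decisionRegion δ k') := by
  intro k k' hne
  refine Set.disjoint_left.2 fun x hx hx' => hne ?_
  exact cell_unique (hx.2.trans_lt (by norm_num)) (hx'.2.trans_lt (by norm_num))

lemma decisionRegion_eq_preimage {e m : ℕ} (hm : 1 ≤ m) (δ : ℝ) (k : Fin e → Fin m) :
    decisionRegion δ k = (fun x : Feature (e + 1) => (x 0, tail e x)) ⁻¹'
      (Set.Icc (1 / 2 - δ) (1 / 2 + δ) ×ˢ Set.Icc (fun i => ((k i : ℝ) + 1 / 4) / m)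
        (fun i => ((k i : ℝ) + 3 / 4) / m)) := by
  have hm0 : (0 : ℝ) < m := by exact_mod_cast hm
  ext x
  simp only [decisionRegion, Set.mem_ofPred_eq, Set.mem_preimage, Set.mem_prod, Set.mem_Icc,
    pi_norm_le_iff_of_nonneg (by norm_num : (0 : ℝ) ≤ 1 / 4), Pi.le_def, ← forall_and]
  refine and_congr ?_ (forall_congr' fun i => ?_)
  · rw [abs_le]
    constructor <;> rintro ⟨h1, h2⟩ <;> constructor <;> linarith
  · rw [div_le_iff₀ hm0, le_div_iff₀ hm0, Real.norm_eq_abs, abs_le]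
    simp only [Pi.sub_apply, Pi.smul_apply, smul_eq_mul, cellCenter]
    constructor <;> rintro ⟨h1, h2⟩ <;> constructor <;> linarith

lemma uniformLaw_decisionRegion {e m : ℕ} (hm : 1 ≤ m) {δ : ℝ} (hδ : 0 ≤ δ) (hδ' : δ ≤ 1 / 8)
    (k : Fin e → Fin m) :
    (uniformLaw (e + 1)).real (decisionRegion δ k) = 2 * δ * (1 / (2 * m)) ^ e := by
  have hm0 : (0 : ℝ) < m := by exact_mod_cast hm
  have hsub : decisionRegion δ k ⊆ unitCube (e + 1) := by
    rw [decisionRegion_eq_preimage hm]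
    rintro x ⟨hx, hx'⟩
    refine Fin.cases ⟨by linarith [hx.1], by linarith [hx.2]⟩ fun i => ⟨?_, ?_⟩
    · exact le_trans (by positivity) (hx'.1 i)
    · refine (hx'.2 i).trans ?_
      rw [div_le_one hm0]
      have : ((k i : ℕ) : ℝ) + 1 ≤ m := by exact_mod_cast (k i).isLt
      linarith
  rw [measureReal_def, uniformLaw, Measure.restrict_apply (measurableSet_decisionRegion δ k),
    Set.inter_eq_self_of_subset_left hsub, decisionRegion_eq_preimage hm,
    (measurePreserving_split e).measure_preimage
      (measurableSet_Icc.prod measurableSet_Icc).nullMeasurableSet,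
    Measure.volume_eq_prod, Measure.prod_prod, ENNReal.toReal_mul, Real.volume_Icc,
    ENNReal.toReal_ofReal (by linarith), Real.volume_Icc_pi_toReal]
  · congr 1
    · ring
    · rw [Finset.prod_congr rfl fun i _ => show ((k i : ℝ) + 3 / 4) / m - ((k i : ℝ) + 1 / 4) / m =
        1 / (2 * m) by field_simp; ring]
      simp
  · intro i
    simp only
    gcongr
    norm_num

lemma signedBumps_of_mem_decisionRegion {e m : ℕ} {δ : ℝ} {k : Fin e → Fin m}
    (σ : (Fin e → Fin m) → Bool) {x : Feature (e + 1)} (hx : x ∈ decisionRegion δ k) :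
    signedBumps σ x = sign (σ k) := by
  unfold signedBumps
  rw [Finset.sum_eq_single k]
  · rw [tubeBump_eq_one hx.2, mul_one]
  · intro k' _ hne
    rw [tubeBump_eq_zero, mul_zero]
    refine not_le.1 fun h => hne ?_
    exact cell_unique (h.trans_lt (by norm_num)) (hx.2.trans_lt (by norm_num))
  · simp

lemma sign_mul_regression_sub_ge {e m : ℕ} {δ : ℝ} {k : Fin e → Fin m}
    (σ : (Fin e → Fin m) → Bool) {x : Feature (e + 1)} (hx : x ∈ decisionRegion δ k) :
    3 / 4 * δ ≤ sign (σ k) * (regression δ σ x - 1 / 2) := by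
  have h1 : |Real.sin (x 0 - 1 / 2)| ≤ δ := Real.abs_sin_le_abs.trans hx.1
  rw [abs_le] at h1
  rw [regression, signedBumps_of_mem_decisionRegion σ hx, slope]
  cases σ k <;> simp only [sign, if_true, Bool.false_eq_true, if_false] <;> linarith

/-! ### Excess risk -/

lemma ClassificationProblem.risk_eq_integral {d : ℕ} (P : ClassificationProblem d)
    {f : Feature d → Bool} (hf : Measurable f) :
    P.risk f = ∫ x, (if f x then 1 - P.eta x else P.eta x) ∂P.marginal := by
  have hη := P.measurable_eta
  have hS : MeasurableSet {z : Feature d × Bool | z.2 ≠ f z.1} :=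
    (measurableSet_eq_fun measurable_snd (hf.comp measurable_fst)).compl
  have hT : MeasurableSet {x | f x = true} := hf (measurableSet_singleton true)
  have h1 : (fun x => (x, true)) ⁻¹' {z : Feature d × Bool | z.2 ≠ f z.1} = {x | f x = true}ᶜ := by
    ext x; cases h : f x <;> simp [h]
  have h2 : (fun x => (x, false)) ⁻¹' {z : Feature d × Bool | z.2 ≠ f z.1} = {x | f x = true} := by
    ext x; cases h : f x <;> simp [h]
  have h3 : P.joint {z | z.2 ≠ f z.1} =
      ∫⁻ x, ENNReal.ofReal (if f x then 1 - P.eta x else P.eta x) ∂P.marginal := by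
    rw [ClassificationProblem.joint, Measure.add_apply, Measure.map_apply (by fun_prop) hS,
      Measure.map_apply (by fun_prop) hS, h1, h2, withDensity_apply _ hT.compl,
      withDensity_apply _ hT, add_comm, ← lintegral_add_compl (μ := P.marginal) _ hT]
    congr 1
    · refine setLIntegral_congr_fun hT fun x hx => ?_
      simp only [Set.mem_ofPred_eq] at hx
      simp [hx]
    · refine setLIntegral_congr_fun hT.compl fun x hx => ?_
      simp only [Set.mem_compl_iff, Set.mem_ofPred_eq, Bool.not_eq_true] at hx
      simp [hx]
  rw [ClassificationProblem.risk, measureReal_def, h3, integral_eq_lintegral_of_nonneg_ae]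
  · refine Filter.Eventually.of_forall fun x => ?_
    have := P.eta_mem x
    simp only [Pi.zero_apply]
    split_ifs <;> linarith [this.1, this.2]
  · exact (Measurable.ite hT (measurable_const.sub hη) hη).aestronglyMeasurable

lemma ClassificationProblem.measurable_bayes {d : ℕ} (P : ClassificationProblem d) :
    Measurable P.bayes :=
  measurable_to_bool (by
    have h : P.bayes ⁻¹' {true} = {x | 1 / 2 ≤ P.eta x} := by
      ext x; simp [ClassificationProblem.bayes]
    rw [h]
    exact measurableSet_le measurable_const P.measurable_eta)

/-- The excess risk is the integral of `|2 η - 1|` over the set where `f` differs from the Bayes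
classifier; it is bounded below by the contribution of disjoint regions on which the Bayes
classifier is constant and `|2 η - 1|` is bounded below. -/
lemma ClassificationProblem.sum_le_excessRisk {d : ℕ} (P : ClassificationProblem d)
    {f : Feature d → Bool} (hf : Measurable f) {κ : Type*} [Fintype κ] {A : κ → Set (Feature d)}
    (hA : ∀ k, MeasurableSet (A k)) (hdisj : Pairwise fun k k' => Disjoint (A k) (A k'))
    {σ : κ → Bool} {c : ℝ} (hc : 0 < c)
    (hgap : ∀ k, ∀ x ∈ A k, c ≤ sign (σ k) * (P.eta x - 1 / 2)) :
    ∑ k, 2 * c * P.marginal.real (A k ∩ {x | f x ≠ σ k}) ≤ P.excessRisk f := by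
  have := P.isProbabilityMeasure_marginal
  have hη := P.measurable_eta
  have hloss : ∀ {g : Feature d → Bool}, Measurable g →
      Integrable (fun x => if g x then 1 - P.eta x else P.eta x) P.marginal := by
    intro g hg
    refine Integrable.of_bound (Measurable.ite (hg (measurableSet_singleton true))
      (measurable_const.sub hη) hη).aestronglyMeasurable 1 (Filter.Eventually.of_forall fun x => ?_)
    have := P.eta_mem x
    rw [Real.norm_eq_abs, abs_le]
    split_ifs <;> constructor <;> linarith [this.1, this.2]
  have hAf : ∀ k, MeasurableSet (A k ∩ {x | f x ≠ σ k}) := fun k =>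
    (hA k).inter (hf (measurableSet_singleton (σ k))).compl
  have h1 : ∑ k, 2 * c * P.marginal.real (A k ∩ {x | f x ≠ σ k}) =
      ∫ x, ∑ k, (A k ∩ {x | f x ≠ σ k}).indicator (fun _ => 2 * c) x ∂P.marginal := by
    rw [integral_finsetSum _ fun k _ => (integrable_const _).indicator (hAf k)]
    refine Finset.sum_congr rfl fun k _ => ?_
    rw [integral_indicator_const _ (hAf k), smul_eq_mul, mul_comm]
  rw [h1, ClassificationProblem.excessRisk, P.risk_eq_integral hf,
    P.risk_eq_integral P.measurable_bayes, ← integral_sub (hloss hf) (hloss P.measurable_bayes)]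
  refine integral_mono (integrable_finsetSum _ fun k _ => (integrable_const _).indicator (hAf k))
    ((hloss hf).sub (hloss P.measurable_bayes)) fun x => ?_
  simp only [ClassificationProblem.bayes, decide_eq_true_eq]
  by_cases hx : ∃ k, x ∈ A k ∩ {x | f x ≠ σ k}
  · obtain ⟨k, hk⟩ := hx
    rw [Finset.sum_eq_single k, Set.indicator_of_mem hk]
    · have h2 := hgap k x hk.1
      have h3 : f x ≠ σ k := hk.2
      cases hs : σ k <;> rw [hs] at h2 h3 <;>
        simp only [sign, if_true, Bool.false_eq_true, if_false] at h2
      · rw [Bool.ne_false_iff.1 h3, if_pos rfl, if_neg (by linarith)]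
        linarith
      · rw [Bool.eq_false_of_not_eq_true h3, if_neg (by simp), if_pos (by linarith)]
        linarith
    · exact fun k' _ hne => Set.indicator_of_notMem
        (fun h => Set.disjoint_left.1 (hdisj hne) h.1 hk.1) _
    · simp
  · push Not at hx
    rw [Finset.sum_eq_zero fun k _ => Set.indicator_of_notMem (hx k) _]
    split_ifs <;> linarith

/-! ### The hypercube of problems -/

/-- The classification problem of the vertex `σ`: the regression function with bumps of height `δ`
and signs `σ`, under the uniform law. -/
noncomputable def vertexProblem {e m : ℕ} {δ : ℝ} (hδ : 0 ≤ δ) (hδ' : δ ≤ 1 / 8)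
    (σ : (Fin e → Fin m) → Bool) : ClassificationProblem (e + 1) where
  eta := regression δ σ
  marginal := uniformLaw (e + 1)
  measurable_eta := measurable_regression δ σ
  eta_mem x := by
    have := regression_mem hδ hδ' σ x
    exact ⟨by linarith [this.1], by linarith [this.2]⟩
  isProbabilityMeasure_marginal := inferInstance
  marginal_compl_unitCube := by
    rw [uniformLaw, Measure.restrict_apply (measurableSet_unitCube _).compl, Set.compl_inter_self,
      measure_empty]

lemma vertexProblem_mem {e m : ℕ} {δ : ℝ} (hδ : 0 ≤ δ) (hδ' : δ ≤ 1 / 8)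
    (σ : (Fin e → Fin m) → Bool) {α lam c₃ c₁ : ℝ} (hσ : IsHolder lam α (regression δ σ))
    (hc₃ : 10 ≤ c₃) (hc₁ : c₁ ≤ 1) :
    vertexProblem hδ hδ' σ ∈ strongProblemClass (e + 1) α 1 0 lam c₃ c₁ := by
  refine ⟨⟨hσ, ⟨?_, fun Δ hΔ => ?_⟩⟩, strongDensity_uniformLaw _ hc₁⟩
  · have h : {x : Feature (e + 1) | |(vertexProblem hδ hδ' σ).eta x - 1 / 2| < 0} = ∅ :=
      Set.eq_empty_of_forall_notMem fun x hx =>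
        absurd (show |_| < (0 : ℝ) from hx) (not_lt.2 (abs_nonneg _))
    rw [h, measureReal_empty]
  · rw [zero_add, Real.rpow_one]
    exact (uniformLaw_margin_le δ σ hΔ.le).trans (mul_le_mul_of_nonneg_right hc₃ hΔ.le)

/-- A label requested at any one point carries little information on the whole vertex: the
neighbours of `σ` differ from `σ` in disjoint tubes, by `2 δ` at most. -/
lemma sum_bernoulliHellinger_regression_le {e m : ℕ} {δ : ℝ} (hδ : 0 ≤ δ) (hδ' : δ ≤ 1 / 8)
    (σ : (Fin e → Fin m) → Bool) (x : Feature (e + 1)) :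
    ∑ k, bernoulliHellinger (regression δ σ x) (regression δ (flip k σ) x) ≤ 16 * δ ^ 2 := by
  have h1 : ∀ k, regression δ σ x - regression δ (flip k σ) x =
      2 * δ * sign (σ k) * tubeBump k x := by
    intro k
    have h2 : signedBumps σ x - signedBumps (flip k σ) x = 2 * sign (σ k) * tubeBump k x := by
      unfold signedBumps
      rw [← Finset.sum_sub_distrib, Finset.sum_eq_single k]
      · rw [flip_apply_self]
        cases σ k <;> simp [sign] <;> ring
      · intro j _ hne
        rw [flip_apply_of_ne hne, sub_self]
      · simp
    unfold regression
    linear_combination δ * h2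
  have h3 : ∑ k : Fin e → Fin m, tubeBump k x ^ 2 ≤ 1 := by
    refine (le_abs_self _).trans ?_
    rw [← Real.norm_eq_abs]
    refine norm_sum_tubes_le ((m : ℝ) • tail e x) _ zero_le_one (fun k => ?_) fun k hk => ?_
    · rw [Real.norm_eq_abs, abs_of_nonneg (sq_nonneg _)]
      exact pow_le_one₀ (tubeBump_mem k x).1 (tubeBump_mem k x).2
    · rw [tubeBump_eq_zero hk]; norm_num
  calc _ ≤ ∑ k : Fin e → Fin m, 16 * δ ^ 2 * tubeBump k x ^ 2 := by
        refine Finset.sum_le_sum fun k _ => ?_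
        refine (bernoulliHellinger_le (regression_mem hδ hδ' _ _)
          (regression_mem hδ hδ' _ _)).trans_eq ?_
        have hs : sign (σ k) ^ 2 = 1 := by rw [← sq_abs, abs_sign, one_pow]
        rw [h1]
        linear_combination 16 * δ ^ 2 * tubeBump k x ^ 2 * hs
    _ = 16 * δ ^ 2 * ∑ k : Fin e → Fin m, tubeBump k x ^ 2 := (Finset.mul_sum _ _ _).symm
    _ ≤ 16 * δ ^ 2 := mul_le_of_le_one_right (by positivity) h3

/-! ### From the average over the hypercube to the supremum -/

lemma Strategy.measurable_labelProb {d n : ℕ} {Ω : Type*} [MeasurableSpace Ω]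
    (S : Strategy d n Ω) {eta : Feature d → ℝ} (heta : Measurable eta) (y : Fin n → Bool) :
    Measurable fun ω => S.labelProb eta ω y := by
  have hb : ∀ b, Measurable fun p => bernoulliMass p b := by
    intro b
    cases b
    · simp only [bernoulliMass, Bool.false_eq_true, if_false]
      fun_prop
    · simp only [bernoulliMass, if_true]
      fun_prop
  exact Finset.measurable_prod _ fun k _ =>
    (hb _).comp ((measurable_const.sumElim heta).comp (S.measurable_query k _))

lemma Strategy.measurable_excessRisk {d n : ℕ} {Ω : Type*} [MeasurableSpace Ω]
    (S : Strategy d n Ω) (P : ClassificationProblem d) (y : Fin n → Bool) :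
    Measurable fun ω => P.excessRisk (S.classifier y ω) := by
  have := P.isProbabilityMeasure_marginal
  have hfin : SFinite P.joint := by
    unfold ClassificationProblem.joint
    have h1 : SFinite (P.marginal.withDensity fun x => ENNReal.ofReal (P.eta x)) := inferInstance
    have h2 : SFinite (P.marginal.withDensity fun x => ENNReal.ofReal (1 - P.eta x)) :=
      inferInstance
    infer_instance
  have hS : MeasurableSet {w : Ω × (Feature d × Bool) | w.2.2 ≠ S.classifier y w.1 w.2.1} :=
    (measurableSet_eq_fun measurable_snd.snd ((S.measurable_classifier y).comp
      (measurable_fst.prodMk measurable_snd.fst))).compl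
  exact (measurable_measure_prodMk_left (ν := P.joint) hS).ennreal_toReal.sub measurable_const

/-- The supremum of the expected excess risks is at least the average over a finite family of
problems with a common marginal law, which is computed seed by seed. -/
lemma Strategy.le_iSup_expectedExcessRisk {d n : ℕ} {Ω : Type*} [MeasurableSpace Ω]
    (S : Strategy d n Ω) {μ : Measure (Feature d)} {ι : Type*} [Fintype ι] [Nonempty ι]
    (P : ι → ClassificationProblem d) (hμ : ∀ i, (P i).marginal = μ)
    {𝓠 : Set (ClassificationProblem d)} (hP : ∀ i, P i ∈ 𝓠) {B : ℝ}
    (hB : ∀ ω, Fintype.card ι * B ≤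
      ∑ i, ∑ y, S.labelProb (P i).eta ω y * (P i).excessRisk (S.classifier y ω)) :
    ENNReal.ofReal B ≤ ⨆ Q ∈ 𝓠, S.expectedExcessRisk Q := by
  have hprob : IsProbabilityMeasure (S.seedLaw μ) := by
    obtain ⟨i⟩ := ‹Nonempty ι›
    rw [← hμ i]
    exact S.isProbabilityMeasure_seedLaw _ (P i).isProbabilityMeasure_marginal
  have hlabel : ∀ i ω y, 0 ≤ S.labelProb (P i).eta ω y := by
    intro i ω y
    refine Finset.prod_nonneg fun k _ => bernoulliMass_nonneg ?_ _
    rcases S.query k (fun j => y (Fin.castLE k.isLt.le j)) ω with u | x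
    · exact ⟨le_rfl, zero_le_one⟩
    · exact (P i).eta_mem x
  have hmeas : ∀ i ∈ Finset.univ, Measurable fun ω => ∑ y : Fin n → Bool,
      ENNReal.ofReal (S.labelProb (P i).eta ω y) *
        ENNReal.ofReal ((P i).excessRisk (S.classifier y ω)) := fun i _ =>
    Finset.measurable_sum _ fun y _ =>
      (S.measurable_labelProb (P i).measurable_eta y).ennreal_ofReal.mul
        (S.measurable_excessRisk (P i) y).ennreal_ofReal
  have h1 : (Fintype.card ι : ENNReal) * ENNReal.ofReal B ≤ ∑ i, S.expectedExcessRisk (P i) := by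
    simp only [Strategy.expectedExcessRisk, hμ]
    rw [← lintegral_finsetSum _ hmeas]
    calc (Fintype.card ι : ENNReal) * ENNReal.ofReal B
        = ∫⁻ _, ENNReal.ofReal (Fintype.card ι * B) ∂(S.seedLaw μ) := by
          rw [lintegral_const, measure_univ, mul_one, ENNReal.ofReal_mul (Nat.cast_nonneg _),
            ENNReal.ofReal_natCast]
      _ ≤ _ := by
          refine lintegral_mono fun ω => (ENNReal.ofReal_le_ofReal (hB ω)).trans ?_
          refine (Finset.le_sum_of_subadditive _ ENNReal.ofReal_zero.le
            (fun _ _ => ENNReal.ofReal_add_le) _ _).trans (Finset.sum_le_sum fun i _ => ?_)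
          refine (Finset.le_sum_of_subadditive _ ENNReal.ofReal_zero.le
            (fun _ _ => ENNReal.ofReal_add_le) _ _).trans (Finset.sum_le_sum fun y _ => ?_)
          rw [ENNReal.ofReal_mul (hlabel i ω y)]
  have h2 : ∑ i, S.expectedExcessRisk (P i) ≤
      (Fintype.card ι : ENNReal) * ⨆ Q ∈ 𝓠, S.expectedExcessRisk Q := by
    rw [← nsmul_eq_mul, ← Finset.card_univ]
    exact Finset.sum_le_card_nsmul _ _ _ fun i _ =>
      le_iSup₂ (f := fun Q (_ : Q ∈ 𝓠) => S.expectedExcessRisk Q) (P i) (hP i)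
  refine (ENNReal.mul_le_mul_iff_right ?_ (ENNReal.natCast_ne_top _)).1 (h1.trans h2)
  exact Nat.cast_ne_zero.2 Fintype.card_ne_zero

/-- For every seed, the sum over the hypercube of the expected excess risks is at least of the
order `δ ^ 2` per vertex, as long as the labels do not suffice to learn the signs of the `m ^ e`
bumps, each of which takes about `δ ^ (-2)` labels. -/
lemma sum_labelProb_mul_excessRisk_ge {e m n : ℕ} (hm : 1 ≤ m) {δ : ℝ} (hδ : 0 < δ)
    (hδ' : δ ≤ 1 / 8) (hn : n * (64 * δ ^ 2) ≤ (m : ℝ) ^ e) {Ω : Type*} [MeasurableSpace Ω]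
    (S : Strategy (e + 1) n Ω) (ω : Ω) :
    Fintype.card ((Fin e → Fin m) → Bool) * (9 / 16 * δ ^ 2 * (1 / 2) ^ e) ≤
      ∑ σ : (Fin e → Fin m) → Bool, ∑ y, S.labelProb (vertexProblem hδ.le hδ' σ).eta ω y *
        (vertexProblem hδ.le hδ' σ).excessRisk (S.classifier y ω) := by
  have hm0 : (0 : ℝ) < m := by exact_mod_cast hm
  have hf : ∀ y, Measurable (S.classifier y ω) := fun y =>
    (S.measurable_classifier y).comp measurable_prodMk_left
  set a : ((Fin e → Fin m) → Bool) → (t : Fin n) → (Fin t → Bool) → ℝ := fun σ t h =>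
    Sum.elim (fun _ => 0) (regression δ σ) (S.query t h ω) with ha_def
  have ha : ∀ σ t h, a σ t h ∈ Set.Icc (0 : ℝ) 1 := by
    intro σ t h
    simp only [ha_def]
    rcases S.query t h ω with u | x
    · exact ⟨le_rfl, zero_le_one⟩
    · exact (vertexProblem hδ.le hδ' σ).eta_mem x
  have hε : ∀ σ t h, ∑ k, bernoulliHellinger (a σ t h) (a (flip k σ) t h) ≤ 16 * δ ^ 2 := by
    intro σ t h
    simp only [ha_def]
    rcases S.query t h ω with u | x
    -- A round without a request records the same label under all vertices.
    · simp only [Sum.elim_inl, bernoulliHellinger_self, Finset.sum_const_zero]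
      positivity
    · exact sum_bernoulliHellinger_regression_le hδ.le hδ' σ x
  set cost : (Fin n → Bool) → (Fin e → Fin m) → Bool → ℝ := fun y k b =>
    2 * (3 / 4 * δ) * (uniformLaw (e + 1)).real (decisionRegion δ k ∩ {x | S.classifier y ω x ≠ b})
    with hcost
  set v : ℝ := 3 * δ ^ 2 * (1 / (2 * m)) ^ e with hv
  have hvcost : ∀ y k, v ≤ cost y k true + cost y k false := by
    intro y k
    have h1 : decisionRegion δ k ⊆ decisionRegion δ k ∩ {x | S.classifier y ω x ≠ true} ∪
        decisionRegion δ k ∩ {x | S.classifier y ω x ≠ false} := by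
      intro x hx
      cases h : S.classifier y ω x
      · exact Or.inl ⟨hx, by simp [h]⟩
      · exact Or.inr ⟨hx, by simp [h]⟩
    have h2 := (measureReal_mono (μ := uniformLaw (e + 1)) h1).trans (measureReal_union_le _ _)
    rw [uniformLaw_decisionRegion hm hδ.le hδ'] at h2
    calc v = 2 * (3 / 4 * δ) * (2 * δ * (1 / (2 * m)) ^ e) := by rw [hv]; ring
      _ ≤ _ := mul_le_mul_of_nonneg_left h2 (by positivity)
      _ = _ := by simp only [hcost]; ring
  have hmain := assouad a ha hε cost (fun y k b => by positivity) hvcost (by positivity)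
  refine le_trans ?_ (hmain.trans ?_)
  · rw [Fintype.card_fun, Fintype.card_bool, Fintype.card_fun, Fintype.card_fin, Fintype.card_fin]
    push_cast
    refine mul_le_mul_of_nonneg_left ?_ (by positivity)
    have h1 : v * (m : ℝ) ^ e = 3 * δ ^ 2 * (1 / 2) ^ e := by
      rw [hv, mul_assoc, ← mul_pow]
      congr 2
      field_simp
    calc 9 / 16 * δ ^ 2 * (1 / 2) ^ e = v / 4 * (3 / 4 * (m : ℝ) ^ e) := by linarith
      _ ≤ v / 4 * ((m : ℝ) ^ e - n * (16 * δ ^ 2)) :=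
          mul_le_mul_of_nonneg_left (by linarith) (by positivity)
  · refine Finset.sum_le_sum fun σ _ => Finset.sum_le_sum fun y _ =>
      mul_le_mul_of_nonneg_left ?_ (adaptiveProb_nonneg (ha σ) y)
    exact (vertexProblem hδ.le hδ' σ).sum_le_excessRisk (hf y)
      (measurableSet_decisionRegion δ) (pairwise_disjoint_decisionRegion δ) (by positivity)
      fun k x hx => sign_mul_regression_sub_ge σ hx

end ActiveLearning

theorem mainTheorem2 (d : ℕ) (hd : 1 ≤ d) (α : ℝ) (hα : 0 < α) :
    ∃ lam₀ : ℝ, 1 ≤ lam₀ ∧ ∃ c₀ : ℝ, 0 < c₀ ∧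
      ∀ lam c₃ c₁ : ℝ, lam₀ ≤ lam → c₀ ≤ c₃ → 0 < c₁ → c₁ ≤ 1 →
        ∃ C : ℝ, 0 < C ∧ ∃ N : ℕ, ∀ n : ℕ, N ≤ n →
          ∀ (Ω : Type*) [MeasurableSpace Ω] (S : ActiveLearning.Strategy d n Ω),
            ENNReal.ofReal (C * (n : ℝ) ^ (-(2 * α / (2 * α + (d : ℝ) - 1)))) ≤
              ⨆ P ∈ ActiveLearning.strongProblemClass d α 1 0 lam c₃ c₁,
                S.expectedExcessRisk P := by
  obtain ⟨e, rfl⟩ : ∃ e, d = e + 1 := ⟨d - 1, by omega⟩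
  obtain ⟨lam₀, hlam₀, hholder⟩ := ActiveLearning.exists_isHolder_regression e hα
  refine ⟨lam₀, hlam₀, 10, by norm_num, fun lam c₃ c₁ hlam hc₃ _ hc₁ => ?_⟩
  refine ⟨9 / 1024 * (1 / 2) ^ e * (2 : ℝ) ^ (-(2 * α)), by positivity, 1, fun n hn Ω _ S => ?_⟩
  -- At the scale `1/m` with `m ^ (2 α + e) ≈ n`, the budget of labels per tube is about `δ ^ (-2)`.
  set s : ℝ := 2 * α + e with hs
  have hs0 : 0 < s := by positivity
  have hn1 : (1 : ℝ) ≤ n := by exact_mod_cast hn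
  have hn0 : (0 : ℝ) < n := by linarith
  set T : ℝ := (n : ℝ) ^ (1 / s) with hT
  have hT1 : 1 ≤ T := Real.one_le_rpow hn1 (by positivity)
  set m : ℕ := ⌈T⌉₊ with hm_def
  have hTm : T ≤ m := Nat.le_ceil T
  have hm1 : 1 ≤ m := by exact_mod_cast hT1.trans hTm
  have hm0 : (0 : ℝ) < m := by exact_mod_cast hm1
  have hmT : (m : ℝ) ≤ 2 * T := by linarith [(Nat.ceil_lt_add_one (by linarith : 0 ≤ T)).le]
  set δ : ℝ := (m : ℝ) ^ (-α) / 8 with hδ_def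
  have hδ : 0 < δ := by positivity
  have hδ' : δ ≤ 1 / 8 := by
    have : (m : ℝ) ^ (-α) ≤ 1 :=
      Real.rpow_le_one_of_one_le_of_nonpos (by exact_mod_cast hm1) (by linarith)
    linarith
  have hδsq : 64 * δ ^ 2 = (m : ℝ) ^ (-(2 * α)) := by
    have h : ((m : ℝ) ^ (-α)) ^ 2 = (m : ℝ) ^ (-(2 * α)) := by
      rw [← Real.rpow_natCast, ← Real.rpow_mul hm0.le]
      congr 1
      push_cast
      ring
    rw [hδ_def, ← h]
    ring
  have hbudget : n * (64 * δ ^ 2) ≤ (m : ℝ) ^ e := by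
    have h1 : (n : ℝ) ≤ (m : ℝ) ^ s := by
      calc (n : ℝ) = T ^ s := by
            rw [hT, ← Real.rpow_mul hn0.le, one_div_mul_cancel hs0.ne', Real.rpow_one]
        _ ≤ (m : ℝ) ^ s := Real.rpow_le_rpow (by linarith) hTm hs0.le
    calc n * (64 * δ ^ 2) ≤ (m : ℝ) ^ s * (m : ℝ) ^ (-(2 * α)) := by
          rw [hδsq]; exact mul_le_mul_of_nonneg_right h1 (by positivity)
      _ = (m : ℝ) ^ e := by
          rw [← Real.rpow_add hm0, ← Real.rpow_natCast]
          congr 1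
          rw [hs]; ring
  have hrate : (2 : ℝ) ^ (-(2 * α)) * (n : ℝ) ^ (-(2 * α / s)) ≤ 64 * δ ^ 2 := by
    have h1 : (n : ℝ) ^ (-(2 * α / s)) = T ^ (-(2 * α)) := by
      rw [hT, ← Real.rpow_mul hn0.le]
      congr 1
      ring
    rw [h1, hδsq, ← Real.mul_rpow (by norm_num) (by linarith)]
    exact Real.rpow_le_rpow_of_nonpos hm0 hmT (by linarith)
  have hexp : 2 * α + ((e + 1 : ℕ) : ℝ) - 1 = s := by rw [hs]; push_cast; ring
  rw [hexp]
  refine le_trans (ENNReal.ofReal_le_ofReal ?_) (S.le_iSup_expectedExcessRisk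
    (P := ActiveLearning.vertexProblem (e := e) (m := m) hδ.le hδ') (fun σ => rfl)
    (fun σ => ActiveLearning.vertexProblem_mem hδ.le hδ' σ (hholder lam hlam m hm1 σ) hc₃ hc₁)
    (ActiveLearning.sum_labelProb_mul_excessRisk_ge hm1 hδ hδ' hbudget S))
  calc 9 / 1024 * (1 / 2) ^ e * (2 : ℝ) ^ (-(2 * α)) * (n : ℝ) ^ (-(2 * α / s))
      = 9 / 1024 * (1 / 2) ^ e * ((2 : ℝ) ^ (-(2 * α)) * (n : ℝ) ^ (-(2 * α / s))) := by ring
    _ ≤ 9 / 1024 * (1 / 2) ^ e * (64 * δ ^ 2) := mul_le_mul_of_nonneg_left hrate (by positivity)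
    _ = 9 / 16 * δ ^ 2 * (1 / 2) ^ e := by ring
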